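/- Let $\mathbb K$ be an algebraically closed field, and write $\underline T=(T_1,T_2)$, $\underline X=(X_1,X_2,X_3)$. Let $C=V(E)\subset\mathbb P^2$ be the curve defined by an irreducible homogeneous polynomial $E\in\mathbb K[\underline X]$. We say that $C$ is parameterizable by a pair $(F_1,F_2)$ of homogeneous polynomials in $\mathbb K[\underline X]$ of the same degree without common factors if there are homogeneous polynomials $u_1,u_2,u_3\in\mathbb K[\underline T]$ of the same degree without common factors such that $\phi=(u_1:u_2:u_3):\mathbb P^1\to C$ and $\psi=(F_1:F_2):C\dashrightarrow\mathbb P^1$ are inverse to each other as rational maps; then $\underline u=(u_1,u_2,u_3)$ is called the proper parameterization of $C$ induced by $(F_1,F_2)$. The curve is parameterizable by lines if it is parameterizable by some pair of degree $1$. Let $C$ have odd degree $d=2k+1$ (that is, $\deg E=2k+1$), let $C$ be parameterizable by a pair $(F_1,F_2)$ of quadratic forms without common factors, with induced proper parameterization $\underline u$, and suppose that $C$ is not parameterizable by lines. Let $I=\langle u_1,u_2,u_3\rangle\subset\mathbb K[\underline T]$, and let $\mathcal K$ be the defining ideal of the Rees algebra of the parameterization, i.e. the kernel of the $\mathbb K[\underline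 T]$-algebra morphism $\mathbb K[\underline T][\underline X]\to\mathrm{Rees}(I)=\mathbb K[\underline T][IZ]$, $X_i\mapsto u_i(\underline T)Z$. Let $\mathcal K_{*,1}$ be the $\mathbb K[\underline T]$-module of the elements of $\mathcal K$ that are homogeneous of degree $1$ in $\underline X$ (the module of syzygies of $u_1,u_2,u_3$), and $\mathcal K_{i,j}$ the set of the elements of $\mathcal K$ that are bihomogeneous of bidegree $(i,j)$ in $(\underline T,\underline X)$. Then $\mathcal K_{*,1}$ has a $\mathbb K[\underline T]$-basis $\{p_{k,1},q_{k+1,1}\}$ (a $\mu$-basis) with $p_{k,1}\in\mathcal K_{k,1}$ and $q_{k+1,1}\in\mathcal K_{k+1,1}$. For any such basis, set $P_k:=p_{k,1}$ and, for $j=k,k-1,\dots,1$, write $P_j=A_jT_1+B_jT_2$ with $A_j,B_j$ bihomogeneous of bidegree $(j-1,d-2j)$ and set $P_{j-1}:=A_jF_1+B_jF_2$. Such a chain $P_k,\dots,P_0$ exists, and whatever choices of the $A_j,B_j$ are made, $P_j\in\mathcal K_{j,d-2j}$ for $0\le j\le k$, $P_0=cE$ for some nonzero constant $c\in\mathbb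 K$, and $$T_1F_2(\underline X)-T_2F_1(\underline X),\quad q_{k+1,1},\quad P_0,\ P_1,\dots,\ P_k$$ is a minimal set of generators of $\mathcal K$: these elements generate $\mathcal K$, and none of them lies in the ideal generated by the others. -/

import Mathlib

noncomputable section

namespace RatCurve

open MvPolynomial

/-- `v` and `w` are homogeneous coordinates of one and the same point of projective space
(in particular both are nonzero). -/
def SamePoint {K : Type*} [Field K] {n : ℕ} (v w : Fin n → K) : Prop :=
  ∃ (hv : v ≠ 0) (hw : w ≠ 0), Projectivization.mk K v hv = Projectivization.mk K w hw

/-- The value `(f_1(x), …, f_m(x))` of a tuple of polynomials. -/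
def evalTuple {K : Type*} [Field K] {n m : ℕ} (f : Fin m → MvPolynomial (Fin n) K)
    (x : Fin n → K) : Fin m → K :=
  fun i => eval x (f i)

/-- The plane curve `C = V(E)`, with `E` irreducible, is parameterizable by the pair
`F = (F_1, F_2)` of forms of degree `e`, and `u = (u_1, u_2, u_3)` is the proper parameterization
of `C` induced by `F`:  `φ = (u_1 : u_2 : u_3) : ℙ¹ → C` and `ψ = (F_1 : F_2) : C ⇢ ℙ¹` are
inverse to each other as rational maps.

A property holds for almost all points of `ℙ¹` if it holds on some basic open set `g ≠ 0` with
`g` a nonzero form, and for almost all points of `C` if it holds on the trace on `C` of some basic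
open set `G ≠ 0` with `G` a form that is not a multiple of `E`. -/
structure IsParameterizableBy {K : Type*} [Field K] (E : MvPolynomial (Fin 3) K) (e : ℕ)
    (F : Fin 2 → MvPolynomial (Fin 3) K) (u : Fin 3 → MvPolynomial (Fin 2) K) : Prop where
  F_homogeneous : ∀ i, (F i).IsHomogeneous e
  /-- `F_1` and `F_2` have no common factor -/
  F_coprime : IsRelPrime (F 0) (F 1)
  u_homogeneous : ∃ n : ℕ, ∀ i, (u i).IsHomogeneous n
  /-- `u_1`, `u_2` and `u_3` have no common factor -/
  u_coprime : ∀ g : MvPolynomial (Fin 2) K, (∀ i, g ∣ u i) → IsUnit g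
  /-- `φ` maps `ℙ¹` to `C` -/
  maps_to : ∀ t : Fin 2 → K, t ≠ 0 → eval (evalTuple u t) E = 0
  /-- `ψ ∘ φ = id` for almost all points of `ℙ¹` -/
  psi_phi : ∃ g : MvPolynomial (Fin 2) K, (∃ m, g.IsHomogeneous m) ∧ g ≠ 0 ∧
    ∀ t : Fin 2 → K, t ≠ 0 → eval t g ≠ 0 → SamePoint (evalTuple F (evalTuple u t)) t
  /-- `φ ∘ ψ = id` for almost all points of `C` -/
  phi_psi : ∃ G : MvPolynomial (Fin 3) K, (∃ m, G.IsHomogeneous m) ∧ ¬ E ∣ G ∧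
    ∀ x : Fin 3 → K, x ≠ 0 → eval x E = 0 → eval x G ≠ 0 →
      SamePoint (evalTuple u (evalTuple F x)) x

/-- The ring `K[T][X]`, with `T = (T_1, T_2)` and `X = (X_1, X_2, X_3)`. -/
abbrev BiPoly (K : Type*) [Field K] : Type _ := MvPolynomial (Fin 3) (MvPolynomial (Fin 2) K)

/-- The variable `T_i` in `K[T][X]`. -/
def varT {K : Type*} [Field K] (i : Fin 2) : BiPoly K := C (X i)

/-- A polynomial in `K[X]`, regarded as an element of `K[T][X]`. -/
def ofX {K : Type*} [Field K] (G : MvPolynomial (Fin 3) K) : BiPoly K := map C G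

/-- `P` is bihomogeneous of bidegree `(i, j)`: degree `i` in `T` and degree `j` in `X`. -/
def IsBihomogeneous {K : Type*} [Field K] (P : BiPoly K) (i j : ℕ) : Prop :=
  P.IsHomogeneous j ∧ ∀ m : Fin 3 →₀ ℕ, (P.coeff m).IsHomogeneous i

/-- The `K[T]`-algebra morphism `K[T][X] → Rees(I)`, `X_i ↦ u_i Z`, where `I = ⟨u_1, u_2, u_3⟩`
and `Rees(I) = K[T][I Z] ⊆ K[T][Z]`. -/
def reesMap {K : Type*} [Field K] (u : Fin 3 → MvPolynomial (Fin 2) K) :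
    BiPoly K →ₐ[MvPolynomial (Fin 2) K] reesAlgebra (Ideal.span (Set.range u)) :=
  aeval fun i => ⟨Polynomial.monomial 1 (u i),
    reesAlgebra.monomial_mem.mpr
      (by rw [pow_one]; exact Ideal.subset_span (Set.mem_range_self i))⟩

/-- The defining ideal of the Rees algebra of the parameterization `u`. -/
def reesIdeal {K : Type*} [Field K] (u : Fin 3 → MvPolynomial (Fin 2) K) : Ideal (BiPoly K) :=
  RingHom.ker (reesMap u)

/-- The `K[T]`-module of the elements of the defining ideal that are homogeneous of degree one
in `X`. An element `∑ a_i(T) X_i` of it is the syzygy `(a_1, a_2, a_3)` of `(u_1, u_2, u_3)`. -/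
def syzModule {K : Type*} [Field K] (u : Fin 3 → MvPolynomial (Fin 2) K) :
    Submodule (MvPolynomial (Fin 2) K) (BiPoly K) :=
  (reesIdeal u).restrictScalars (MvPolynomial (Fin 2) K) ⊓
    homogeneousSubmodule (Fin 3) (MvPolynomial (Fin 2) K) 1

/-- `p` and `q`, homogeneous of `T`-degrees `μ` and `ν`, form a basis of the `K[T]`-module of
syzygies of `(u_1, u_2, u_3)`. -/
structure IsMuBasis {K : Type*} [Field K] (u : Fin 3 → MvPolynomial (Fin 2) K) (μ ν : ℕ)
    (p q : BiPoly K) : Prop where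
  bihomogeneous_p : IsBihomogeneous p μ 1
  bihomogeneous_q : IsBihomogeneous q ν 1
  linearIndependent : LinearIndependent (MvPolynomial (Fin 2) K) ![p, q]
  span_eq : Submodule.span (MvPolynomial (Fin 2) K) {p, q} = syzModule u

/-- `P_k, P_{k-1}, …, P_0` is obtained from `P_k = p` by successively writing
`P_{j+1} = A T_1 + B T_2`, with `A` and `B` bihomogeneous of the appropriate bidegree (that of
`P_{j+1}` lowered by one in `T`), and setting `P_j = A F_1 + B F_2`. -/
def IsChain {K : Type*} [Field K] (F : Fin 2 → MvPolynomial (Fin 3) K) (k : ℕ) (p : BiPoly K)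
    (P : ℕ → BiPoly K) : Prop :=
  P k = p ∧ ∀ j < k, ∃ A B : BiPoly K,
    IsBihomogeneous A j (2 * (k - (j + 1)) + 1) ∧ IsBihomogeneous B j (2 * (k - (j + 1)) + 1) ∧
    P (j + 1) = A * varT 0 + B * varT 1 ∧ P j = A * ofX (F 0) + B * ofX (F 1)

/-- The family `g` is a minimal set of generators of the ideal `I`: it generates `I`, and none of
its members lies in the ideal generated by the others. -/
def IsMinimalGenerators {R ι : Type*} [CommRing R] (I : Ideal R) (g : ι → R) : Prop :=
  Ideal.span (Set.range g) = I ∧ ∀ i, g i ∉ Ideal.span (g '' {i}ᶜ)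

/-- The family `T_1 F_2 - T_2 F_1, q, P_0, …, P_k`. -/
def generators {K : Type*} [Field K] (F : Fin 2 → MvPolynomial (Fin 3) K) (k : ℕ) (q : BiPoly K)
    (P : ℕ → BiPoly K) : Fin 2 ⊕ Fin (k + 1) → BiPoly K :=
  Sum.elim ![varT 0 * ofX (F 1) - varT 1 * ofX (F 0), q] (fun j => P j)

end RatCurve

end

noncomputable section

namespace RatCurve

open MvPolynomial

/-! ### Homogeneous polynomials and ideals with homogeneous generators -/

section Homogeneous

variable {σ R S : Type*} [CommRing R] [CommRing S] [Algebra R S]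

/-! Read an element f of the Rees ideal as a polynomial in T over K[X] and substitute T ↦ F(X).
Write Q = T₁F₂ − T₂F₁ (`pencil`). A T-form is killed by this substitution exactly when Q divides it
(`pencil_dvd_of_eval_eq_zero`), and a T-form in the Rees ideal is sent to a multiple of E
(`IsParameterizableBy.dvd_eval`). All members of a chain have the same image, because AT₁ + BT₂ and
AF₁ + BF₂ both become AF₁ + BF₂. For p this image is a nonzero form of degree 2k + 1, hence cE with
c ≠ 0. So an f of T-degree i ≤ k is a multiple of P_i modulo Q
(`IsParameterizableBy.exists_eq_add`).

For T-degree at least k, f lies in J = (p, q, Q). The Koszul syzygies u_iX_j − u_jX_i belong to (p,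
q), and T₁ is in the radical of (u₁, u₂, u₃), so T₁^N f ∈ (p, q) for some N. It remains to cancel T₁
modulo J (`mem_of_X_zero_mul_mem`). On T₁ = 0 the forms p and q become independent linear forms L,
L' in X with F₁ ∈ (L, L'). The relations among p, q, Q on that line are then generated by two, which
lift to elements T₁S₁, T₁S₂ of J; S₁ and S₂ have T-degree k, where the first argument applies.

All this needs a μ-basis in degrees k and k + 1, hence deg u = 2k + 1. The bound deg u ≤ deg E is a
computation of field degrees (`degree_le_of_ne_zero`). Conversely, T ↦ F(X) embeds the syzygies of
degree k into the line K·E, while a dimension count leaves at least 2k + 2 − deg u of them. The same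
count produces p and q, and p × q = cu with c ≠ 0 makes them a basis.

Minimality is read off from bidegrees: at most one other generator can contribute to a given one,
and divisibility by it is excluded. This uses k ≠ 0, which is what the exclusion of lines provides:
for k = 0 the parameterization is linear and C is a line. -/

theorem aeval_mul_of_isHomogeneous [Fintype σ] {f : MvPolynomial σ R} {m : ℕ}
    (hf : f.IsHomogeneous m) (c : S) (x : σ → S) :
    aeval (fun i => c * x i) f = c ^ m * aeval x f := by
  simp only [aeval_def, eval₂_eq', Finset.mul_sum]
  refine Finset.sum_congr rfl fun d hd => ?_
  have hdeg : ∑ i, d i = m := by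
    rw [← Finsupp.degree_eq_sum, Finsupp.degree_eq_weight_one]
    exact hf (mem_support_iff.mp hd)
  simp only [mul_pow, Finset.prod_mul_distrib, Finset.prod_pow_eq_pow_sum, hdeg]
  ring

theorem aeval_sub_aeval_mem (I : Ideal S) {x y : σ → S} (h : ∀ i, x i - y i ∈ I)
    (f : MvPolynomial σ R) : aeval x f - aeval y f ∈ I := by
  rw [← Ideal.Quotient.eq]
  have hxy : (fun i => Ideal.Quotient.mkₐ R I (x i)) = fun i => Ideal.Quotient.mkₐ R I (y i) :=
    funext fun i => Ideal.Quotient.eq.mpr (h i)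
  have h' : Ideal.Quotient.mkₐ R I (aeval x f) = Ideal.Quotient.mkₐ R I (aeval y f) := by
    rw [comp_aeval_apply, comp_aeval_apply, hxy]
  exact h'

attribute [local instance] MvPolynomial.gradedAlgebra

theorem decompose_eq_homogeneousComponent (f : MvPolynomial σ R) (m : ℕ) :
    (DirectSum.decompose (homogeneousSubmodule σ R) f m : MvPolynomial σ R) =
      homogeneousComponent m f :=
  decomposition.decompose'_apply f m

theorem homogeneousComponent_mul_of_le {b : MvPolynomial σ R} {i n : ℕ} (hb : b.IsHomogeneous i)
    (a : MvPolynomial σ R) (h : i ≤ n) :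
    homogeneousComponent n (a * b) = homogeneousComponent (n - i) a * b := by
  simp only [← decompose_eq_homogeneousComponent]
  exact DirectSum.coe_decompose_mul_of_right_mem_of_le _ hb h

theorem homogeneousComponent_mul_of_not_le {b : MvPolynomial σ R} {i n : ℕ}
    (hb : b.IsHomogeneous i) (a : MvPolynomial σ R) (h : ¬ i ≤ n) :
    homogeneousComponent n (a * b) = 0 := by
  simp only [← decompose_eq_homogeneousComponent]
  exact DirectSum.coe_decompose_mul_of_right_mem_of_not_le _ hb h

/-- A homogeneous element of an ideal with homogeneous generators is already in the ideal
generated by those generators whose degree does not exceed its own. -/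
theorem mem_span_of_degree_le {ι : Type*} {g : ι → MvPolynomial σ R} {e : ι → ℕ}
    (hg : ∀ i, (g i).IsHomogeneous (e i)) {s : Set ι} {f : MvPolynomial σ R} {m : ℕ}
    (hf : f.IsHomogeneous m) (h : f ∈ Ideal.span (g '' s)) :
    f ∈ Ideal.span (g '' {i ∈ s | e i ≤ m}) := by
  rw [← homogeneousComponent_eq_self hf]
  clear hf
  induction h using Submodule.span_induction with
  | mem x hx =>
    obtain ⟨i, hi, rfl⟩ := hx
    rw [homogeneousComponent_of_mem (hg i)]
    split_ifs with h
    · exact Ideal.subset_span ⟨i, ⟨hi, h.ge⟩, rfl⟩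
    · exact zero_mem _
  | zero => simp
  | add x y _ _ hx hy => rw [map_add]; exact add_mem hx hy
  | smul a x hx _ =>
    clear * - hg hx
    rw [smul_eq_mul]
    induction hx using Submodule.span_induction generalizing a with
    | mem x hx =>
      obtain ⟨i, hi, rfl⟩ := hx
      by_cases h : e i ≤ m
      · rw [homogeneousComponent_mul_of_le (hg i) _ h]
        exact Ideal.mul_mem_left _ _ (Ideal.subset_span ⟨i, ⟨hi, h⟩, rfl⟩)
      · rw [homogeneousComponent_mul_of_not_le (hg i) _ h]
        exact zero_mem _
    | zero => simp
    | add x y _ _ hx hy => rw [mul_add, map_add]; exact add_mem (hx a) (hy a)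
    | smul b x _ hx => rw [smul_eq_mul, ← mul_assoc]; exact hx _

end Homogeneous

/-! ### Binary forms in T over a ring, the pencil T₁F₂ − T₂F₁, and cancelling T₁ -/

section Pencil

variable {A : Type*} [CommRing A]

/-- The linear form `T_1 F_2 - T_2 F_1`. -/
def pencil (F : Fin 2 → A) : MvPolynomial (Fin 2) A := X 0 * C (F 1) - X 1 * C (F 0)

theorem pencil_isHomogeneous (F : Fin 2 → A) : (pencil F).IsHomogeneous 1 := by
  simp only [pencil, mul_comm (X _)]
  exact (isHomogeneous_C_mul_X _ _).sub (isHomogeneous_C_mul_X _ _)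

theorem eval_pencil (F : Fin 2 → A) : eval F (pencil F) = 0 := by
  simp [pencil, mul_comm]

/-- The two terms are f evaluated at T_i·F and at F_i·T, and these vectors agree modulo the pencil.
-/
theorem pencil_dvd (F : Fin 2 → A) {f : MvPolynomial (Fin 2) A} {m : ℕ} (hf : f.IsHomogeneous m)
    (i : Fin 2) : pencil F ∣ X i ^ m * C (eval F f) - C (F i) ^ m * f := by
  have h1 : X i ^ m * C (eval F f) = aeval (fun j => (X i : MvPolynomial (Fin 2) A) * C (F j)) f := by
    rw [aeval_mul_of_isHomogeneous hf]
    congr 1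
    rw [aeval_def, eval₂_eq', eval_eq']
    simp
  have h2 : C (F i) ^ m * f = aeval (fun j => C (F i) * (X j : MvPolynomial (Fin 2) A)) f := by
    rw [aeval_mul_of_isHomogeneous hf, aeval_X_left_apply]
  rw [h1, h2, ← Ideal.mem_span_singleton]
  refine aeval_sub_aeval_mem _ (fun j => ?_) f
  rw [Ideal.mem_span_singleton]
  fin_cases i <;> fin_cases j
  · simp [mul_comm]
  · exact ⟨1, by simp [pencil]; ring⟩
  · exact ⟨-1, by simp [pencil]; ring⟩
  · simp [mul_comm]

/-- The pencil of `![0, 1]` is `X 0`, so `pencil_dvd` becomes the division of f by T₁ with the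
restriction to T₁ = 0 as remainder. -/
theorem exists_eq_C_mul_X_pow_add {f : MvPolynomial (Fin 2) A} {m : ℕ} (hf : f.IsHomogeneous m) :
    ∃ g, f = C (eval ![0, 1] f) * X 1 ^ m + X 0 * g := by
  obtain ⟨g, hg⟩ := pencil_dvd ![0, 1] hf 1
  refine ⟨-g, ?_⟩
  simp [pencil] at hg
  linear_combination -hg

variable [IsDomain A]

theorem not_pencil_dvd_C {F : Fin 2 → A} {a : A} (ha : a ≠ 0) :
    ¬ pencil F ∣ C a := by
  rintro ⟨s, hs⟩
  have hne : C a ≠ (0 : MvPolynomial (Fin 2) A) := by simpa using ha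
  have hp : pencil F ≠ 0 := left_ne_zero_of_mul (hs ▸ hne)
  have hs0 : s ≠ 0 := right_ne_zero_of_mul (hs ▸ hne)
  have := congrArg totalDegree hs
  rw [totalDegree_C, totalDegree_mul_of_isDomain hp hs0,
    (pencil_isHomogeneous F).totalDegree hp] at this
  omega

theorem pencil_prime [UniqueFactorizationMonoid A] {F : Fin 2 → A} (hF : IsRelPrime (F 0) (F 1))
    (h0 : F 0 ≠ 0) : Prime (pencil F) := by
  rw [← UniqueFactorizationMonoid.irreducible_iff_prime]
  have key : pencil F = sumSMulX (Finsupp.equivFunOnFinite.symm ![F 1, -F 0]) := by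
    rw [sumSMulX, Finsupp.linearCombination_apply, Finsupp.sum_fintype _ _ (by simp)]
    simp [pencil, MvPolynomial.smul_eq_C_mul]
    ring
  rw [key]
  refine irreducible_sumSMulX _ ⟨1, by simpa using h0⟩ fun r hr => hF ?_ ?_
  · simpa using hr 1
  · simpa using hr 0

/-- By `pencil_dvd` the pencil divides F₁^m f; it is prime and, being of degree 1 in T, does not
divide the nonzero constant F₁. -/
theorem pencil_dvd_of_eval_eq_zero [UniqueFactorizationMonoid A] {F : Fin 2 → A}
    (hF : IsRelPrime (F 0) (F 1)) (h0 : F 0 ≠ 0) {f : MvPolynomial (Fin 2) A} {m : ℕ}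
    (hf : f.IsHomogeneous m) (h : eval F f = 0) : pencil F ∣ f := by
  have := pencil_dvd F hf 0
  rw [h, C_0, mul_zero, zero_sub, dvd_neg] at this
  rcases (pencil_prime hF h0).dvd_or_dvd this with h | h
  · exact absurd ((pencil_prime hF h0).dvd_of_dvd_pow h) (not_pencil_dvd_C h0)
  · exact h

/-- The cancellation step. P will be the Rees ideal, `hk` the already settled T-degree k, and L, L'
the restrictions of p, q to T = (0, 1). A relation ap + bq + cQ divisible by T₁ is, on T₁ = 0, a
combination of the Koszul relation of L, L' and of F₁ = αL + βL'; subtracting lifts of these makes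
the coefficients divisible by T₁. -/
theorem mem_of_X_zero_mul_mem {F : Fin 2 → A} {k : ℕ} {p q : MvPolynomial (Fin 2) A}
    (hp : p.IsHomogeneous k) (hq : q.IsHomogeneous (k + 1)) {P : Ideal (MvPolynomial (Fin 2) A)}
    [hP : P.IsPrime] (hX : X 0 ∉ P) (hJ : Ideal.span {p, q, pencil F} ≤ P)
    (hk : ∀ f ∈ P, f.IsHomogeneous k → f ∈ Ideal.span {p, q, pencil F}) {α β : A}
    (hF : F 0 = α * eval ![0, 1] p + β * eval ![0, 1] q)
    (hsyz : ∀ x y, x * eval ![0, 1] p + y * eval ![0, 1] q = 0 →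
      ∃ s, x = s * eval ![0, 1] q ∧ y = -s * eval ![0, 1] p)
    {f : MvPolynomial (Fin 2) A} {i : ℕ} (hf : f.IsHomogeneous i) (hi : k ≤ i)
    (h : X 0 * f ∈ Ideal.span {p, q, pencil F}) : f ∈ Ideal.span {p, q, pencil F} := by
  set J := Ideal.span {p, q, pencil F} with hJdef
  have hpJ : p ∈ J := Ideal.subset_span (by simp)
  have hqJ : q ∈ J := Ideal.subset_span (by simp)
  have hQJ : pencil F ∈ J := Ideal.subset_span (by simp)
  have hX0 : (X 0 : MvPolynomial (Fin 2) A) ≠ 0 := X_ne_zero 0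
  -- A T₁-multiple of degree k + 1 in J can be divided by T₁: the quotient lies in the prime P and
  -- has degree k, so `hk` returns it to J.
  have memJ : ∀ g S : MvPolynomial (Fin 2) A, g ∈ J → g.IsHomogeneous (k + 1) → g = X 0 * S →
      S ∈ J := by
    intro g S hg hgk hgS
    have hSP : S ∈ P := (hP.mem_or_mem (hgS ▸ hJ hg)).resolve_left hX
    by_cases hS : S = 0
    · rw [hS]; exact zero_mem _
    have hSk : homogeneousComponent k S = S := by
      have h1 : homogeneousComponent (k + 1) (S * X 0) = S * X 0 :=
        homogeneousComponent_eq_self (by rwa [mul_comm, ← hgS])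
      rw [homogeneousComponent_mul_of_le (isHomogeneous_X _ 0) _ (by omega)] at h1
      simpa using mul_right_cancel₀ hX0 h1
    exact hk S hSP (hSk ▸ homogeneousComponent_isHomogeneous k S)
  obtain ⟨p', hp'⟩ := exists_eq_C_mul_X_pow_add hp
  obtain ⟨q', hq'⟩ := exists_eq_C_mul_X_pow_add hq
  set L := eval ![0, 1] p
  set L' := eval ![0, 1] q
  -- On T₁ = 0 the pencil is −T₂F₁, so F₁ = αL + βL' makes this combination vanish there.
  obtain ⟨S₁, hS₁⟩ : ∃ S, C α * X 1 * p + C β * q + X 1 ^ k * pencil F = X 0 * S := by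
    refine ⟨C α * X 1 * p' + C β * q' + X 1 ^ k * C (F 1), ?_⟩
    have hF' : (C (F 0) : MvPolynomial (Fin 2) A) = C α * C L + C β * C L' := by simp [hF]
    rw [pencil]
    linear_combination (C α * X 1) * hp' + C β * hq' - X 1 ^ (k + 1) * hF'
  -- Lift of the Koszul relation; the factor T₂ evens out the degrees k and k + 1.
  obtain ⟨S₂, hS₂⟩ : ∃ S, C L' * X 1 * p - C L * q = X 0 * S := by
    refine ⟨C L' * X 1 * p' - C L * q', ?_⟩
    linear_combination (C L' * X 1) * hp' - C L * hq'
  have hC1 : ∀ a : A, (C a * X 1 : MvPolynomial (Fin 2) A).IsHomogeneous 1 :=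
    fun a => isHomogeneous_C_mul_X a 1
  have hS₁J : S₁ ∈ J := by
    refine memJ _ _ ?_ ?_ hS₁
    · exact add_mem (add_mem (J.mul_mem_left _ hpJ) (J.mul_mem_left _ hqJ)) (J.mul_mem_left _ hQJ)
    · refine ((?_ : IsHomogeneous _ _).add (hq.C_mul _)).add
        ((isHomogeneous_X_pow _ _).mul (pencil_isHomogeneous F))
      rw [add_comm k 1]; exact (hC1 α).mul hp
  have hS₂J : S₂ ∈ J := by
    refine memJ _ _ ?_ ?_ hS₂
    · exact sub_mem (J.mul_mem_left _ hpJ) (J.mul_mem_left _ hqJ)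
    · refine (?_ : IsHomogeneous _ _).sub (hq.C_mul _)
      rw [add_comm k 1]; exact (hC1 L').mul hp
  obtain ⟨a, b', hb', hab⟩ := Ideal.mem_span_insert.mp h
  obtain ⟨b, c, hbc⟩ := Ideal.mem_span_pair.mp hb'
  have heq : X 0 * f = a * p + b * q + c * pencil F := by linear_combination -hbc + hab
  clear hbc hab hb' b' h
  -- The coefficients may be taken homogeneous: with i = k + e their degrees become e + 1, e and k +
  -- e.
  have hcomp := congrArg (homogeneousComponent (i + 1)) heq
  rw [map_add, map_add, homogeneousComponent_mul_of_le hp _ (by omega),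
    homogeneousComponent_mul_of_le hq _ (by omega),
    homogeneousComponent_mul_of_le (pencil_isHomogeneous F) _ (by omega), mul_comm (X 0) f,
    homogeneousComponent_mul_of_le (isHomogeneous_X _ 0) _ (by omega), Nat.add_sub_cancel,
    homogeneousComponent_eq_self hf] at hcomp
  obtain ⟨e, rfl⟩ := Nat.exists_eq_add_of_le hi
  have e1 : k + e + 1 - k = e + 1 := by omega
  have e2 : k + e + 1 - (k + 1) = e := by omega
  rw [e1, e2] at hcomp
  obtain ⟨a', ha'⟩ := exists_eq_C_mul_X_pow_add (homogeneousComponent_isHomogeneous (e + 1) a)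
  obtain ⟨b', hb'⟩ := exists_eq_C_mul_X_pow_add (homogeneousComponent_isHomogeneous e b)
  obtain ⟨c', hc'⟩ := exists_eq_C_mul_X_pow_add (homogeneousComponent_isHomogeneous (k + e) c)
  set a₁ := homogeneousComponent (e + 1) a
  set b₁ := homogeneousComponent e b
  set c₁ := homogeneousComponent (k + e) c
  set a₀ := eval ![0, 1] a₁
  set b₀ := eval ![0, 1] b₁
  set c₀ := eval ![0, 1] c₁
  have hrel : (a₀ - c₀ * α) * L + (b₀ - c₀ * β) * L' = 0 := by
    have := congrArg (eval ![0, 1]) hcomp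
    simp only [map_add, map_mul, eval_X, pencil, map_sub, eval_C] at this
    simp only [Matrix.cons_val_zero, Matrix.cons_val_one, mul_zero, zero_mul, zero_sub,
      one_mul] at this
    change 0 = a₀ * L + b₀ * L' + c₀ * (-F 0) at this
    rw [hF] at this
    linear_combination -this
  obtain ⟨s, hs1, hs2⟩ := hsyz _ _ hrel
  have ha₀ : (C a₀ : MvPolynomial (Fin 2) A) = C c₀ * C α + C s * C L' := by
    rw [← C_mul, ← C_mul, ← C_add]; congr 1; linear_combination hs1
  have hb₀ : (C b₀ : MvPolynomial (Fin 2) A) = C c₀ * C β - C s * C L := by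
    rw [← C_mul, ← C_mul, ← C_sub]; congr 1; linear_combination hs2
  have hfin : f = a' * p + b' * q + c' * pencil F + X 1 ^ e * (C c₀ * S₁ + C s * S₂) := by
    apply mul_left_cancel₀ hX0
    linear_combination hcomp + p * ha' + q * hb' + pencil F * hc' + X 1 ^ (e + 1) * p * ha₀ +
      X 1 ^ e * q * hb₀ + X 1 ^ e * C c₀ * hS₁ + X 1 ^ e * C s * hS₂
  rw [hfin]
  exact add_mem (add_mem (add_mem (J.mul_mem_left _ hpJ) (J.mul_mem_left _ hqJ))
    (J.mul_mem_left _ hQJ)) (J.mul_mem_left _ (add_mem (J.mul_mem_left _ hS₁J)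
    (J.mul_mem_left _ hS₂J)))

theorem mem_of_X_zero_pow_mul_mem {F : Fin 2 → A} {k : ℕ} {p q : MvPolynomial (Fin 2) A}
    (hp : p.IsHomogeneous k) (hq : q.IsHomogeneous (k + 1)) {P : Ideal (MvPolynomial (Fin 2) A)}
    [hP : P.IsPrime] (hX : X 0 ∉ P) (hJ : Ideal.span {p, q, pencil F} ≤ P)
    (hk : ∀ f ∈ P, f.IsHomogeneous k → f ∈ Ideal.span {p, q, pencil F}) {α β : A}
    (hF : F 0 = α * eval ![0, 1] p + β * eval ![0, 1] q)
    (hsyz : ∀ x y, x * eval ![0, 1] p + y * eval ![0, 1] q = 0 →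
      ∃ s, x = s * eval ![0, 1] q ∧ y = -s * eval ![0, 1] p)
    {f : MvPolynomial (Fin 2) A} {i : ℕ} (hf : f.IsHomogeneous i) (hi : k ≤ i) (N : ℕ)
    (h : X 0 ^ N * f ∈ Ideal.span {p, q, pencil F}) : f ∈ Ideal.span {p, q, pencil F} := by
  induction N with
  | zero => simpa using h
  | succ N ih =>
    refine ih (mem_of_X_zero_mul_mem hp hq hX hJ hk hF hsyz (i := 1 * N + i)
      ((isHomogeneous_X _ 0).pow N |>.mul hf) (by omega) ?_)
    rwa [← mul_assoc, ← pow_succ']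

end Pencil

/-! ### Exchanging the roles of T and X -/

section Swap

variable {K : Type*} [Field K]

/-- The ring `K[T][X]`, with the roles of the variables exchanged. -/
abbrev swap : BiPoly K ≃ₐ[K] MvPolynomial (Fin 2) (MvPolynomial (Fin 3) K) :=
  commAlgEquiv K (Fin 3) (Fin 2)

theorem coeff_swap (f : BiPoly K) (m : Fin 3 →₀ ℕ) (n : Fin 2 →₀ ℕ) :
    coeff m (coeff n (swap f)) = coeff n (coeff m f) := by
  induction f using MvPolynomial.induction_on' with
  | add p q hp hq => simp only [map_add, coeff_add, hp, hq]
  | monomial d a =>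
    induction a using MvPolynomial.induction_on' with
    | add p q hp hq =>
      simp only [map_add, coeff_add] at hp hq ⊢
      rw [hp, hq]
    | monomial e a =>
      have : swap (monomial d (monomial e a)) = monomial e (monomial d a) := by
        simp [swap, commAlgEquiv, monomial]
      rw [this]
      classical
      simp only [coeff_monomial]
      by_cases h1 : d = m <;> by_cases h2 : e = n <;> simp [h1, h2, coeff_monomial]

theorem swap_isHomogeneous_iff {f : BiPoly K} {i : ℕ} :
    (swap f).IsHomogeneous i ↔ ∀ m, (f.coeff m).IsHomogeneous i := by
  constructor
  · intro h m n hn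
    refine h fun h0 => hn ?_
    rw [← coeff_swap, h0, coeff_zero]
  · intro h n hn
    obtain ⟨m, hm⟩ := ne_zero_iff.mp hn
    exact h m (by rwa [← coeff_swap])

theorem swap_varT (i : Fin 2) : swap (varT i : BiPoly K) = X i := commAlgEquiv_C_X i

theorem swap_ofX (G : MvPolynomial (Fin 3) K) : swap (ofX G) = C G := by
  induction G using MvPolynomial.induction_on with
  | C a => simp [ofX, swap]
  | add p q hp hq => simp only [ofX, map_add] at hp hq ⊢; rw [hp, hq]
  | mul_X p i hp => simp only [ofX, map_mul, map_X] at hp ⊢; rw [hp]; simp [swap]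

theorem swap_C (a : MvPolynomial (Fin 2) K) : swap (C a) = map C a := commAlgEquiv_C a

/-- The component of degree `i` in `T`. -/
def tComponent (i : ℕ) (f : BiPoly K) : BiPoly K :=
  swap.symm (homogeneousComponent i (swap f))

theorem coeff_tComponent (i : ℕ) (f : BiPoly K) (m : Fin 3 →₀ ℕ) :
    coeff m (tComponent i f) = homogeneousComponent i (coeff m f) := by
  ext n
  rw [← coeff_swap, tComponent, AlgEquiv.apply_symm_apply, coeff_homogeneousComponent,
    coeff_homogeneousComponent, ← coeff_swap]
  split_ifs <;> simp

theorem sum_tComponent (f : BiPoly K) :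
    ∑ i ∈ Finset.range ((swap f).totalDegree + 1), tComponent i f = f := by
  simp only [tComponent]
  rw [← map_sum, sum_homogeneousComponent, AlgEquiv.symm_apply_apply]

theorem homogeneousComponent_tComponent (i j : ℕ) (f : BiPoly K) :
    homogeneousComponent j (tComponent i f) = tComponent i (homogeneousComponent j f) := by
  ext1 m
  rw [coeff_tComponent, coeff_homogeneousComponent, coeff_homogeneousComponent, coeff_tComponent]
  split_ifs <;> simp

end Swap

/-! ### The Rees ideal: membership, primality and bigrading -/

section Rees

variable {K : Type*} [Field K] (u : Fin 3 → MvPolynomial (Fin 2) K)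

theorem coe_reesMap (f : BiPoly K) : (reesMap u f : Polynomial (MvPolynomial (Fin 2) K)) =
    aeval (fun i => Polynomial.X * Polynomial.C (u i)) f := by
  have : (reesAlgebra (Ideal.span (Set.range u))).val.comp (reesMap u) =
      aeval (fun i => Polynomial.X * Polynomial.C (u i)) := by
    ext i : 1
    rw [AlgHom.comp_apply, reesMap, aeval_X, aeval_X]
    change Polynomial.monomial 1 (u i) = _
    rw [← Polynomial.C_mul_X_pow_eq_monomial, pow_one, mul_comm]
  exact DFunLike.congr_fun this f

/-- The power of Z records the degree in X: the coefficient of Z^j in the image of f is the value at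
u of the component of X-degree j. -/
theorem mem_reesIdeal_iff {f : BiPoly K} :
    f ∈ reesIdeal u ↔ ∀ j, aeval u (homogeneousComponent j f) = 0 := by
  have key : ∀ j, Polynomial.coeff
      (aeval (fun i => Polynomial.X * Polynomial.C (u i)) f) j =
        aeval u (homogeneousComponent j f) := by
    intro j
    have h1 : ∀ (g : BiPoly K) (i : ℕ), g.IsHomogeneous i →
        aeval (fun i => Polynomial.X * Polynomial.C (u i)) g =
          Polynomial.X ^ i * Polynomial.C (aeval u g) := by
      intro g i hg
      rw [aeval_mul_of_isHomogeneous hg]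
      congr 1
      exact (comp_aeval_apply (f := u)
        (Algebra.ofId (MvPolynomial (Fin 2) K) (Polynomial (MvPolynomial (Fin 2) K))) g).symm
    conv_lhs => rw [← sum_homogeneousComponent f]
    rw [map_sum, Polynomial.finsetSum_coeff, Finset.sum_congr rfl fun i _ => by
      rw [h1 _ i (homogeneousComponent_isHomogeneous i f), mul_comm, Polynomial.coeff_C_mul_X_pow]]
    rw [Finset.sum_ite_eq]
    split_ifs with h
    · rfl
    · rw [homogeneousComponent_eq_zero, map_zero]
      simpa using h
  rw [reesIdeal, RingHom.mem_ker, ← ZeroMemClass.coe_eq_zero, coe_reesMap, Polynomial.ext_iff]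
  exact forall_congr' fun j => by rw [key, Polynomial.coeff_zero]

theorem mem_reesIdeal_iff_of_isHomogeneous {f : BiPoly K} {j : ℕ} (hf : f.IsHomogeneous j) :
    f ∈ reesIdeal u ↔ aeval u f = 0 := by
  rw [mem_reesIdeal_iff]
  constructor
  · intro h
    simpa [homogeneousComponent_eq_self hf] using h j
  · intro h i
    rw [homogeneousComponent_of_mem hf]
    split_ifs <;> simp [h]

instance reesIdeal_isPrime : (reesIdeal u).IsPrime := RingHom.ker_isPrime _

/-- A monomial of degree j in X becomes a form of degree nj under X ↦ u, so T-degrees are all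
shifted by the same amount and the Rees ideal is also graded in T. -/
theorem aeval_tComponent {n : ℕ} (hu : ∀ i, (u i).IsHomogeneous n) {f : BiPoly K} {j : ℕ}
    (hf : f.IsHomogeneous j) (i : ℕ) :
    aeval u (tComponent i f) = homogeneousComponent (i + n * j) (aeval u f) := by
  have hsub : (tComponent i f).support ⊆ f.support := by
    intro m hm
    rw [mem_support_iff, coeff_tComponent] at hm
    rw [mem_support_iff]
    exact fun h => hm (by rw [h, map_zero])
  rw [aeval_def, aeval_def, eval₂_eq', eval₂_eq', map_sum, Finset.sum_subset hsub]
  · refine Finset.sum_congr rfl fun m hm => ?_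
    have hh : (∏ x, u x ^ m x).IsHomogeneous (n * j) := by
      have := IsHomogeneous.prod Finset.univ (fun x => u x ^ m x) (fun x => n * m x)
        fun x _ => (hu x).pow (m x)
      rw [← Finset.mul_sum, ← Finsupp.degree_eq_sum, Finsupp.degree_eq_weight_one] at this
      have hw : Finsupp.weight (fun _ => 1) m = j := hf (mem_support_iff.mp hm)
      rwa [hw] at this
    rw [homogeneousComponent_mul_of_le hh _ (by omega), Nat.add_sub_cancel, coeff_tComponent]
    rfl
  · intro m _ hm
    rw [notMem_support_iff.mp hm]; simp

theorem tComponent_mem_reesIdeal {n : ℕ} (hu : ∀ i, (u i).IsHomogeneous n) {f : BiPoly K}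
    (hf : f ∈ reesIdeal u) (i : ℕ) : tComponent i f ∈ reesIdeal u := by
  rw [mem_reesIdeal_iff] at hf ⊢
  intro j
  rw [homogeneousComponent_tComponent,
    aeval_tComponent u hu (homogeneousComponent_isHomogeneous j f), hf j, map_zero]

theorem varT_notMem_reesIdeal (i : Fin 2) : varT i ∉ reesIdeal u := by
  rw [varT, mem_reesIdeal_iff_of_isHomogeneous u
    (isHomogeneous_C _ (X i : MvPolynomial (Fin 2) K))]
  simp

theorem aeval_ofX (G : MvPolynomial (Fin 3) K) : aeval u (ofX G) = aeval u G := by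
  rw [ofX, aeval_def, eval₂_map, aeval_def]; rfl

theorem homogeneousComponent_ofX (G : MvPolynomial (Fin 3) K) (j : ℕ) :
    homogeneousComponent j (ofX G) = ofX (homogeneousComponent j G) := by
  ext1 m
  simp only [ofX, coeff_homogeneousComponent, coeff_map]
  split_ifs <;> simp

end Rees

/-! ### Translating the birational hypotheses into polynomial identities -/

section Forms

variable {K : Type*} [Field K]

/-- At a common zero t, the linear form defining the point t would be a common factor. -/
theorem exists_eval_ne_zero {u : Fin 3 → MvPolynomial (Fin 2) K} {n : ℕ}
    (hu : ∀ i, (u i).IsHomogeneous n)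
    (hc : ∀ g : MvPolynomial (Fin 2) K, (∀ i, g ∣ u i) → IsUnit g) {t : Fin 2 → K} (ht : t ≠ 0) :
    ∃ i, eval t (u i) ≠ 0 := by
  by_contra! h
  obtain ⟨j, hj⟩ := Function.ne_iff.mp ht
  have hunit : IsUnit (pencil t) := by
    refine hc _ fun i => ?_
    have := pencil_dvd t (hu i) j
    rw [h i, C_0, mul_zero, zero_sub, dvd_neg, ← C_pow] at this
    refine (IsUnit.dvd_mul_left ?_).mp this
    exact (IsUnit.mk0 _ (pow_ne_zero _ hj)).map C
  exact (hunit.map (eval t)).ne_zero (eval_pencil t)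

/-- Nullstellensatz: the only common zero of the u_i is at most the origin. -/
theorem X_zero_mem_radical_span [IsAlgClosed K] {u : Fin 3 → MvPolynomial (Fin 2) K} {n : ℕ}
    (hu : ∀ i, (u i).IsHomogeneous n)
    (hc : ∀ g : MvPolynomial (Fin 2) K, (∀ i, g ∣ u i) → IsUnit g) :
    X 0 ∈ (Ideal.span (Set.range u)).radical := by
  rw [← vanishingIdeal_zeroLocus_eq_radical (K := K), mem_vanishingIdeal_iff]
  intro t ht
  by_contra h0
  have htne : t ≠ 0 := by rintro rfl; simp at h0
  obtain ⟨i, hi⟩ := exists_eval_ne_zero hu hc htne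
  exact hi (ht _ (Ideal.subset_span ⟨i, rfl⟩))

variable {E : MvPolynomial (Fin 3) K} {e : ℕ} {F : Fin 2 → MvPolynomial (Fin 3) K}
  {u : Fin 3 → MvPolynomial (Fin 2) K}

theorem SamePoint.exists_smul {m : ℕ} {v w : Fin m → K} (h : SamePoint v w) :
    ∃ c : K, c ≠ 0 ∧ c • w = v := by
  obtain ⟨hv, hw, h⟩ := h
  obtain ⟨c, hc⟩ := (Projectivization.mk_eq_mk_iff K v w hv hw).mp h
  exact ⟨c, c.ne_zero, hc⟩

theorem eval_smul_of_isHomogeneous {σ : Type*} [Fintype σ] {G : MvPolynomial σ K} {m : ℕ}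
    (hG : G.IsHomogeneous m) (c : K) (x : σ → K) : eval (c • x) G = c ^ m * eval x G := by
  exact aeval_mul_of_isHomogeneous hG c x

theorem eval_evalTuple {m n : ℕ} {u : Fin m → MvPolynomial (Fin n) K} (t : Fin n → K)
    (G : MvPolynomial (Fin m) K) :
    eval (evalTuple u t) G = eval t (aeval u G) := by
  exact (comp_aeval_apply (aeval t : MvPolynomial (Fin n) K →ₐ[K] K) (f := u) G).symm

/-- At a point x of C where G₀ ≠ 0, u(F(x)) is proportional to x, so G vanishes at x. Thus G₀G
vanishes on all of V(E), and the Nullstellensatz together with the primality of E gives E ∣ G. -/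
theorem IsParameterizableBy.dvd_of_aeval_eq_zero [IsAlgClosed K] (h : IsParameterizableBy E e F u)
    (hE : Irreducible E) {G : MvPolynomial (Fin 3) K} {m : ℕ} (hG : G.IsHomogeneous m)
    (h0 : aeval u G = 0) : E ∣ G := by
  obtain ⟨G₀, ⟨m₀, hG₀⟩, hEG₀, hpt⟩ := h.phi_psi
  have hprime : Prime E := UniqueFactorizationMonoid.irreducible_iff_prime.mp hE
  have hG0 : eval 0 G = 0 := by
    by_cases hm : m = 0
    · subst hm
      obtain ⟨c, rfl⟩ : ∃ c, G = C c :=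
        ⟨_, totalDegree_eq_zero_iff_eq_C.mp ((totalDegree_zero_iff_isHomogeneous _).mpr hG)⟩
      simpa [MvPolynomial.algebraMap_eq] using h0
    · have := eval_smul_of_isHomogeneous hG 0 0
      simpa [hm] using this
  have hrad : G₀ * G ∈ (Ideal.span {E}).radical := by
    rw [← vanishingIdeal_zeroLocus_eq_radical (K := K), mem_vanishingIdeal_iff]
    intro x hx
    have hEx : eval x E = 0 := hx E (Ideal.mem_span_singleton_self E)
    change eval x (G₀ * G) = 0
    rw [map_mul]
    by_cases hx0 : x = 0
    · rw [hx0, hG0, mul_zero]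
    by_cases hG₀x : eval x G₀ = 0
    · rw [hG₀x, zero_mul]
    obtain ⟨c, hc, hcx⟩ := (hpt x hx0 hEx hG₀x).exists_smul
    have : eval (c • x) G = 0 := by rw [hcx, eval_evalTuple, h0, map_zero]
    rw [eval_smul_of_isHomogeneous hG] at this
    rw [(mul_eq_zero.mp this).resolve_left (pow_ne_zero _ hc), mul_zero]
  obtain ⟨N, hN⟩ := hrad
  exact (hprime.dvd_or_dvd (hprime.dvd_of_dvd_pow (Ideal.mem_span_singleton.mp hN))).resolve_left
    hEG₀

theorem IsParameterizableBy.dvd_of_ofX_mem [IsAlgClosed K] (h : IsParameterizableBy E e F u)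
    (hE : Irreducible E) {G : MvPolynomial (Fin 3) K} (hG : ofX G ∈ reesIdeal u) : E ∣ G := by
  rw [mem_reesIdeal_iff] at hG
  rw [← sum_homogeneousComponent G]
  refine Finset.dvd_sum fun j _ =>
    h.dvd_of_aeval_eq_zero hE (homogeneousComponent_isHomogeneous j G) ?_
  rw [← aeval_ofX, ← homogeneousComponent_ofX]
  exact hG j

theorem IsParameterizableBy.aeval_eq_zero [Infinite K] (h : IsParameterizableBy E e F u)
    (hEhom : ∃ d, d ≠ 0 ∧ E.IsHomogeneous d) :
    aeval u E = 0 := by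
  obtain ⟨n, hu⟩ := h.u_homogeneous
  obtain ⟨d, hd, hE⟩ := hEhom
  -- The factor `X 0` takes care of t = 0, where `maps_to` says nothing.
  have : aeval u E * X 0 = 0 := by
    refine MvPolynomial.funext fun t => ?_
    by_cases ht : t = 0
    · simp [ht]
    · rw [map_mul, ← eval_evalTuple, h.maps_to t ht]; simp
  exact (mul_eq_zero.mp this).resolve_right (X_ne_zero 0)

theorem IsParameterizableBy.X_mul_aeval [Infinite K] (h : IsParameterizableBy E e F u) :
    X 0 * aeval u (F 1) = X 1 * aeval u (F 0) := by
  obtain ⟨g, -, hg, hpt⟩ := h.psi_phi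
  have : (X 0 * aeval u (F 1) - X 1 * aeval u (F 0)) * g = 0 := by
    refine MvPolynomial.funext fun t => ?_
    by_cases ht : t = 0
    · simp [ht]
    by_cases hgt : eval t g = 0
    · simp [hgt]
    obtain ⟨c, -, hc⟩ := (hpt t ht hgt).exists_smul
    have h0 := congrFun hc 0
    have h1 := congrFun hc 1
    simp only [Pi.smul_apply, smul_eq_mul] at h0 h1
    change _ = eval _ _ at h0 h1
    have e0 := eval_evalTuple (u := u) t (F 0)
    have e1 := eval_evalTuple (u := u) t (F 1)
    simp only [map_mul, map_sub, eval_X, ← e0, ← e1, ← h0, ← h1, map_zero]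
    ring
  exact sub_eq_zero.mp ((mul_eq_zero.mp this).resolve_right hg)

theorem IsParameterizableBy.aeval_F_ne_zero [Infinite K] (h : IsParameterizableBy E e F u) :
    aeval u (F 1) ≠ 0 := by
  intro h1
  have h0 : aeval u (F 0) = 0 := by
    have := h.X_mul_aeval
    rw [h1, mul_zero] at this
    exact (mul_eq_zero.mp this.symm).resolve_left (X_ne_zero 1)
  obtain ⟨g, -, hg, hpt⟩ := h.psi_phi
  have : g * X 0 = 0 := by
    refine MvPolynomial.funext fun t => ?_
    by_contra hne
    simp only [map_mul, eval_X, map_zero, mul_eq_zero, not_or] at hne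
    have ht : t ≠ 0 := by rintro rfl; simp at hne
    obtain ⟨hv, -⟩ := hpt t ht hne.1
    refine hv (funext fun i => ?_)
    change eval (evalTuple u t) (F i) = 0
    rw [eval_evalTuple]
    fin_cases i
    · exact h0 ▸ map_zero _
    · exact h1 ▸ map_zero _
  exact hg ((mul_eq_zero.mp this).resolve_right (X_ne_zero 0))

theorem IsParameterizableBy.F_zero_ne_zero (h : IsParameterizableBy E e F u) (he : e ≠ 0) :
    F 0 ≠ 0 := by
  intro h0
  have hunit : IsUnit (F 1) := h.F_coprime (h0 ▸ dvd_zero _) dvd_rfl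
  have h2 := (h.F_homogeneous 1).totalDegree hunit.ne_zero
  rw [(isUnit_iff_totalDegree_of_isReduced.mp hunit).2] at h2
  exact he h2.symm

end Forms

/-! ### Dehomogenizing binary forms -/

section Dehomogenization

variable {K : Type*} [Field K]

theorem eq_zero_of_eval_eq_zero_of_eq_one [Infinite K] {σ : Type*} [Fintype σ]
    {G : MvPolynomial σ K} {m : ℕ} (hG : G.IsHomogeneous m) (i : σ)
    (h : ∀ x : σ → K, x i = 1 → eval x G = 0) : G = 0 := by
  have : G * X i = 0 := by
    refine MvPolynomial.funext fun x => ?_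
    by_cases hx : x i = 0
    · simp [hx]
    · have h1 := h ((x i)⁻¹ • x) (by simp [hx])
      rw [eval_smul_of_isHomogeneous hG] at h1
      simp [(mul_eq_zero.mp h1).resolve_left (pow_ne_zero _ (inv_ne_zero hx))]
  exact (mul_eq_zero.mp this).resolve_right (X_ne_zero i)

/-- The substitution `T_1 = t`, `T_2 = 1`. -/
def dehomogenize : MvPolynomial (Fin 2) K →ₐ[K] Polynomial K := aeval ![Polynomial.X, 1]

theorem eval_dehomogenize (s : K) (G : MvPolynomial (Fin 2) K) :
    (dehomogenize G).eval s = eval ![s, 1] G := by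
  have := comp_aeval_apply (f := ![Polynomial.X, 1]) (Polynomial.aeval s : Polynomial K →ₐ[K] K) G
  rw [dehomogenize, ← Polynomial.coe_aeval_eq_eval]
  refine this.trans ?_
  have h : (fun i => Polynomial.aeval s ((![Polynomial.X, 1] : Fin 2 → Polynomial K) i)) =
      ![s, 1] := by
    funext i; fin_cases i <;> simp
  rw [h]; rfl

theorem dehomogenize_eq_zero [Infinite K] {G : MvPolynomial (Fin 2) K} {m : ℕ}
    (hG : G.IsHomogeneous m) (h : dehomogenize G = 0) : G = 0 := by
  refine eq_zero_of_eval_eq_zero_of_eq_one hG 1 fun x hx => ?_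
  have := eval_dehomogenize (x 0) G
  rw [h, Polynomial.eval_zero] at this
  rw [this]
  congr 2
  funext i; fin_cases i <;> simp [hx]

/-- The value at the point at infinity survives as the coefficient of degree m; it detects whether
the degree drops. -/
theorem coeff_dehomogenize {G : MvPolynomial (Fin 2) K} {m : ℕ} (hG : G.IsHomogeneous m) :
    (dehomogenize G).coeff m = eval ![1, 0] G := by
  rw [dehomogenize, aeval_def, eval₂_eq', eval_eq', Polynomial.finsetSum_coeff]
  refine Finset.sum_congr rfl fun d hd => ?_
  have hw : d 0 + d 1 = m := by
    have : d.degree = m := by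
      rw [Finsupp.degree_eq_weight_one]
      exact hG (mem_support_iff.mp hd)
    rwa [Finsupp.degree_eq_sum, Fin.sum_univ_two] at this
  simp only [Fin.prod_univ_two, Matrix.cons_val_zero, Matrix.cons_val_one, one_pow, mul_one,
    one_mul, Polynomial.algebraMap_eq, Polynomial.coeff_C_mul, Polynomial.coeff_X_pow]
  by_cases h1 : d 1 = 0
  · rw [if_pos (by omega), h1, pow_zero]
  · rw [if_neg (by omega), zero_pow h1]

/-- Since a and b are coprime, they divide the normalized numerator and denominator; so the degree
of w as a rational function is at least that of a and b. -/
theorem le_max_natDegree {a b : Polynomial K} (hab : IsCoprime a b) (hb : b ≠ 0) :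
    let w : RatFunc K := algebraMap _ _ a / algebraMap _ _ b
    a.natDegree ≤ w.num.natDegree ∧ b.natDegree ≤ w.denom.natDegree := by
  intro w
  have hb' : algebraMap (Polynomial K) (RatFunc K) b ≠ 0 :=
    RatFunc.algebraMap_ne_zero hb
  have hd' : algebraMap (Polynomial K) (RatFunc K) w.denom ≠ 0 :=
    RatFunc.algebraMap_ne_zero w.denom_ne_zero
  have hrel : w.num * b = a * w.denom := by
    apply RatFunc.algebraMap_injective K
    have h1 := RatFunc.num_div_denom w
    rw [div_eq_iff hd'] at h1
    rw [map_mul, map_mul, h1]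
    simp only [w]
    field_simp
  have hbd : b ∣ w.denom := hab.symm.dvd_of_dvd_mul_left (hrel ▸ dvd_mul_left _ _)
  have had : a ∣ w.num := hab.dvd_of_dvd_mul_right (hrel ▸ dvd_mul_right _ _)
  refine ⟨?_, Polynomial.natDegree_le_of_dvd hbd w.denom_ne_zero⟩
  by_cases hw : w.num = 0
  · have ha : a = 0 := by
      rw [hw, zero_mul, eq_comm, mul_eq_zero] at hrel
      exact hrel.resolve_right w.denom_ne_zero
    simp [ha]
  · exact Polynomial.natDegree_le_of_dvd had hw

end Dehomogenization

/-! ### Upper bound: the degree of the parameterization is at most that of the curve -/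

section Degree

variable {K : Type*} [Field K] [IsAlgClosed K]

theorem exists_combination_ne_zero {u : Fin 3 → MvPolynomial (Fin 2) K} {n : ℕ}
    (hu : ∀ i, (u i).IsHomogeneous n) (hc : ∀ t : Fin 2 → K, t ≠ 0 → ∃ i, eval t (u i) ≠ 0)
    (h0 : u 0 ≠ 0) :
    ∃ c : K, ∀ t : Fin 2 → K, t ≠ 0 → eval t (u 0) ≠ 0 ∨ eval t (u 1 + C c * u 2) ≠ 0 := by
  classical
  have hKinf : Infinite K := IsAlgClosed.instInfinite
  -- B t is the set of c that are bad at t. It has at most one element, since u₁, u₂, u₃ have no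
  -- common zero, and u₁ has finitely many zeros up to scaling.
  let B : (Fin 2 → K) → Set K := fun t => {c | eval t (u 0) = 0 ∧ eval t (u 1 + C c * u 2) = 0}
  have hB : ∀ t, t ≠ 0 → (B t).Finite := by
    intro t ht
    refine Set.Subsingleton.finite fun x hx y hy => ?_
    obtain ⟨i, hi⟩ := hc t ht
    simp only [B, Set.mem_ofPred_eq, map_add, map_mul, eval_C] at hx hy
    have h2 : (x - y) * eval t (u 2) = 0 := by linear_combination hx.2 - hy.2
    rcases mul_eq_zero.mp h2 with h | h
    · exact sub_eq_zero.mp h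
    · exfalso
      rw [h, mul_zero, add_zero] at hx
      fin_cases i
      · exact hi hx.1
      · exact hi hx.2
      · exact hi h
  have hfin : ((⋃ s ∈ (dehomogenize (u 0)).roots.toFinset, B ![s, 1]) ∪ B ![1, 0]).Finite :=
    (Set.Finite.biUnion (Finset.finite_toSet _) fun s _ => hB _ (by simp)).union
      (hB _ (by simp))
  obtain ⟨c, hcB⟩ := hfin.exists_notMem
  refine ⟨c, fun t ht => ?_⟩
  by_contra! hcon
  have huc : (u 1 + C c * u 2).IsHomogeneous n := (hu 1).add ((hu 2).C_mul c)
  refine hcB ?_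
  by_cases ht1 : t 1 = 0
  · right
    have ht0 : t 0 ≠ 0 := fun h => ht (funext fun i => by fin_cases i <;> simp [h, ht1])
    have hts : t = t 0 • ![1, 0] := by funext i; fin_cases i <;> simp [ht1]
    rw [hts, eval_smul_of_isHomogeneous (hu 0), eval_smul_of_isHomogeneous huc] at hcon
    exact ⟨(mul_eq_zero.mp hcon.1).resolve_left (pow_ne_zero _ ht0),
      (mul_eq_zero.mp hcon.2).resolve_left (pow_ne_zero _ ht0)⟩
  · left
    have hts : t = t 1 • ![t 0 / t 1, 1] := by
      funext i; fin_cases i <;> simp [ht1, mul_div_cancel₀]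
    rw [hts, eval_smul_of_isHomogeneous (hu 0), eval_smul_of_isHomogeneous huc] at hcon
    have e0 := (mul_eq_zero.mp hcon.1).resolve_left (pow_ne_zero _ ht1)
    have e1 := (mul_eq_zero.mp hcon.2).resolve_left (pow_ne_zero _ ht1)
    refine Set.mem_biUnion (x := t 0 / t 1) ?_ ⟨e0, e1⟩
    simp only [SetLike.mem_coe, Multiset.mem_toFinset]
    rw [Polynomial.mem_roots (fun h => h0 (dehomogenize_eq_zero (hu 0) h)), Polynomial.IsRoot.def,
      eval_dehomogenize]
    exact e0

open IntermediateField in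
-- Over K(w), y is a root of E(1, w − cY, Y), a polynomial of degree at most d in Y, and y generates
-- K(t).
theorem finrank_le_of_aeval_eq_zero {E : MvPolynomial (Fin 3) K} {d : ℕ}
    (hE : E.IsHomogeneous d) (hE0 : E ≠ 0) {w y : RatFunc K} {c : K} (hw : ¬ ∃ κ, w = RatFunc.C κ)
    (hEy : aeval ![1, w - algebraMap K _ c * y, y] E = 0) (hy : K⟮w⟯⟮y⟯ = ⊤) :
    Module.finrank K⟮w⟯ (RatFunc K) ≤ d := by
  have hKinf : Infinite K := IsAlgClosed.instInfinite
  set M := K⟮w⟯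
  let wM : M := ⟨w, mem_adjoin_simple_self K w⟩
  let g : Fin 3 → Polynomial M :=
    ![1, Polynomial.C wM - Polynomial.C (algebraMap K M c) * Polynomial.X, Polynomial.X]
  let g₀ : Fin 3 → Polynomial (Polynomial K) :=
    ![1, Polynomial.C Polynomial.X - Polynomial.C (Polynomial.C c) * Polynomial.X, Polynomial.X]
  have hdeg : (aeval g E).natDegree ≤ d := by
    rw [← aeval_map_algebraMap M g E]
    have := aeval_natDegree_le (n := 1) (map (algebraMap K M) E)
      (hE.map _).totalDegree_le g (fun i => by
        fin_cases i
        · simp [g]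
        · simp only [g]
          refine (Polynomial.natDegree_sub_le _ _).trans (max_le ?_ ?_)
          · simp
          · exact (Polynomial.natDegree_C_mul_le _ _).trans Polynomial.natDegree_X_le
        · simp [g])
    simpa using this
  have hroot : Polynomial.aeval y (aeval g E) = 0 := by
    have := comp_aeval_apply (f := g) ((Polynomial.aeval y : Polynomial M →ₐ[M] RatFunc K).restrictScalars K) E
    refine this.trans ?_
    rw [← hEy]
    congr 2
    funext i
    fin_cases i
    · simp [g]
    · simp [g, wM]
    · simp [g]
  -- As w is transcendental over K, vanishing would already hold with w replaced by a variable W.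
  have hne : aeval g E ≠ 0 := by
    intro h
    have hinj : Function.Injective (Polynomial.aeval wM : Polynomial K →ₐ[K] M) := by
      have h1 := transcendental_iff_injective.mp (RatFunc.transcendental_of_ne_C w hw)
      have h2 : (Polynomial.aeval w : Polynomial K →ₐ[K] RatFunc K) =
          M.val.comp (Polynomial.aeval wM) := by ext; simp [wM]
      rw [h2, AlgHom.coe_comp] at h1
      exact h1.of_comp
    have hmap := comp_aeval_apply (f := g₀) (Polynomial.mapAlgHom (Polynomial.aeval wM)) E
    have hg : (fun i => Polynomial.mapAlgHom (Polynomial.aeval wM) (g₀ i)) = g := by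
      funext i
      fin_cases i
      · simp [g, g₀]
      · simp [g, g₀]
      · simp [g, g₀]
    rw [hg, h] at hmap
    have hθ : aeval g₀ E = 0 := by
      apply Polynomial.map_injective _ hinj
      rw [Polynomial.map_zero]
      exact hmap
    refine hE0 (eq_zero_of_eval_eq_zero_of_eq_one hE 0 fun x hx => ?_)
    -- W ↦ x₂ + cx₃ and Y ↦ x₃ sends (1, W − cY, Y) to an arbitrary point with first coordinate 1.
    let ev : Polynomial (Polynomial K) →ₐ[K] K :=
      (Polynomial.aeval (x 1 + c * x 2)).comp
        ((Polynomial.aeval (Polynomial.C (x 2)) :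
          Polynomial (Polynomial K) →ₐ[Polynomial K] Polynomial K).restrictScalars K)
    have h1 := comp_aeval_apply (f := g₀) ev E
    rw [hθ, map_zero] at h1
    have h2 : (fun i => ev (g₀ i)) = x := by
      funext i
      fin_cases i
      · simp [g₀, hx]
      · simp [g₀, ev]
      · simp [g₀, ev]
    rw [h2] at h1
    exact h1.symm
  have hint : IsIntegral M y := IsAlgebraic.isIntegral ⟨_, hne, hroot⟩
  rw [← finrank_top' (F := M) (E := RatFunc K), ← hy, adjoin.finrank hint]
  exact (Polynomial.natDegree_le_of_dvd (minpoly.dvd _ _ hroot) hne).trans hdeg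

open IntermediateField in
-- In the affine chart u₁ ≠ 0 take w = (u₂ + cu₃)/u₁ and y = u₃/u₁, with c general so that numerator
-- and denominator of w have no common zero. Then [K(t) : K(w)] is at least n, while K(t) = K(w)(y)
-- because t = F₁/F₂ on the curve.
theorem degree_le_of_ne_zero {E : MvPolynomial (Fin 3) K} {d n e : ℕ}
    {F : Fin 2 → MvPolynomial (Fin 3) K} {u : Fin 3 → MvPolynomial (Fin 2) K}
    (hE : E.IsHomogeneous d) (hE0 : E ≠ 0) (hu : ∀ i, (u i).IsHomogeneous n)
    (hc : ∀ t : Fin 2 → K, t ≠ 0 → ∃ i, eval t (u i) ≠ 0) (hEu : aeval u E = 0)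
    (hF : ∀ i, (F i).IsHomogeneous e) (hrel : X 0 * aeval u (F 1) = X 1 * aeval u (F 0))
    (hF1 : aeval u (F 1) ≠ 0) (h0 : u 0 ≠ 0) : n ≤ d := by
  have hKinf : Infinite K := IsAlgClosed.instInfinite
  obtain ⟨c, hcop⟩ := exists_combination_ne_zero hu hc h0
  set a := dehomogenize (u 1 + C c * u 2) with ha
  set b := dehomogenize (u 0) with hb
  have huc : (u 1 + C c * u 2).IsHomogeneous n := (hu 1).add ((hu 2).C_mul c)
  have hb0 : b ≠ 0 := fun h => h0 (dehomogenize_eq_zero (hu 0) h)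
  have hab : IsCoprime a b := by
    rw [Polynomial.isCoprime_iff_aeval_ne_zero_of_isAlgClosed K K]
    intro s
    simp only [Polynomial.coe_aeval_eq_eval, ha, hb, eval_dehomogenize]
    exact (hcop ![s, 1] (by simp)).symm
  -- The two forms do not both vanish at infinity, so one of them keeps degree n.
  have hn : n ≤ max a.natDegree b.natDegree := by
    rcases hcop ![1, 0] (by simp) with h | h
    · rw [← coeff_dehomogenize (hu 0)] at h
      exact le_max_of_le_right (Polynomial.le_natDegree_of_ne_zero h)
    · rw [← coeff_dehomogenize huc] at h
      exact le_max_of_le_left (Polynomial.le_natDegree_of_ne_zero h)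
  let ι := algebraMap (Polynomial K) (RatFunc K)
  let v : Fin 3 → RatFunc K := fun i => ι (dehomogenize (u i))
  have hv0 : v 0 ≠ 0 := RatFunc.algebraMap_ne_zero hb0
  set w : RatFunc K := ι a / ι b with hw
  set y : RatFunc K := v 2 / v 0 with hy
  have hY : (![1, w - algebraMap K _ c * y, y] : Fin 3 → RatFunc K) = fun i => (v 0)⁻¹ * v i := by
    have hιc : ι (Polynomial.C c) = algebraMap K (RatFunc K) c := by
      simp [ι]
    funext i
    fin_cases i
    · simp [hv0]
    · have h1 : ι a = v 1 + algebraMap K _ c * v 2 := by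
        simp only [ha, map_add, map_mul, v, ← hιc]
        congr 3
        simp [dehomogenize]
      simp only [hw, h1, hy]
      change (v 1 + _) / v 0 - _ = (v 0)⁻¹ * v 1
      field_simp
      ring
    · simp [hy, div_eq_inv_mul]
  have hval : ∀ {m : ℕ} {G : MvPolynomial (Fin 3) K}, G.IsHomogeneous m →
      aeval ![1, w - algebraMap K _ c * y, y] G =
        (v 0)⁻¹ ^ m * ι (dehomogenize (aeval u G)) := by
    intro m G hG
    rw [hY, aeval_mul_of_isHomogeneous hG]
    congr 1
    exact (comp_aeval_apply (f := u)
      ((IsScalarTower.toAlgHom K (Polynomial K) (RatFunc K)).comp dehomogenize) G).symm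
  -- If w is constant, a is a multiple of b, coprimality makes both of degree zero, and n = 0.
  by_cases hwC : ∃ κ, w = RatFunc.C κ
  · obtain ⟨κ, hκ⟩ := hwC
    have haκ : a = Polynomial.C κ * b := by
      apply RatFunc.algebraMap_injective K
      have hb' : ι b ≠ 0 := hv0
      rw [hw, div_eq_iff hb'] at hκ
      rw [map_mul, RatFunc.algebraMap_C]
      exact hκ
    have hbu : IsUnit b := hab.isUnit_of_dvd' (haκ ▸ dvd_mul_left _ _) dvd_rfl
    have hbd := Polynomial.natDegree_eq_zero_of_isUnit hbu
    have had : a.natDegree ≤ 0 := haκ ▸ (Polynomial.natDegree_C_mul_le _ _).trans hbd.le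
    rw [hbd] at hn
    have : n ≤ 0 := hn.trans (max_le had le_rfl)
    omega
  have hmax := le_max_natDegree hab hb0
  have hfin : n ≤ Module.finrank K⟮w⟯ (RatFunc K) := by
    rw [RatFunc.finrank_eq_max_natDegree]
    exact hn.trans (max_le_max hmax.1 hmax.2)
  refine hfin.trans (finrank_le_of_aeval_eq_zero hE hE0 hwC (c := c) (y := y) ?_ ?_)
  · rw [hval hE, hEu, map_zero, map_zero, mul_zero]
  · have hX : RatFunc.X ∈ K⟮w⟯⟮y⟯ := by
      have hmem : ∀ G : MvPolynomial (Fin 3) K,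
          aeval ![1, w - algebraMap K _ c * y, y] G ∈ K⟮w⟯⟮y⟯ := by
        intro G
        have hyM : y ∈ K⟮w⟯⟮y⟯ := mem_adjoin_simple_self _ y
        have hwM : w ∈ K⟮w⟯⟮y⟯ :=
          K⟮w⟯⟮y⟯.algebraMap_mem (⟨w, mem_adjoin_simple_self K w⟩ : K⟮w⟯)
        have hcM : algebraMap K (RatFunc K) c ∈ K⟮w⟯⟮y⟯ :=
          K⟮w⟯⟮y⟯.algebraMap_mem (algebraMap K K⟮w⟯ c)
        let Y : Fin 3 → K⟮w⟯⟮y⟯ :=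
          ![1, ⟨w - algebraMap K _ c * y, sub_mem hwM (mul_mem hcM hyM)⟩, ⟨y, hyM⟩]
        have := comp_aeval_apply (f := Y) (K⟮w⟯⟮y⟯.val.restrictScalars K) G
        have hYY : (fun i => K⟮w⟯⟮y⟯.val.restrictScalars K (Y i)) =
            ![1, w - algebraMap K _ c * y, y] := by
          funext i; fin_cases i <;> simp [Y]
        rw [hYY] at this
        rw [← this]
        exact (aeval Y G).2
      have hδ : ι Polynomial.X * ι (dehomogenize (aeval u (F 1))) =
          ι (dehomogenize (aeval u (F 0))) := by
        have := congrArg (fun p => ι (dehomogenize p)) hrel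
        simpa [dehomogenize] using this
      have hXX : RatFunc.X * aeval ![1, w - algebraMap K _ c * y, y] (F 1) =
          aeval ![1, w - algebraMap K _ c * y, y] (F 0) := by
        rw [hval (hF 0), hval (hF 1), ← hδ]
        simp only [ι, RatFunc.algebraMap_X]
        ring
      have hF1' : aeval ![1, w - algebraMap K _ c * y, y] (F 1) ≠ 0 := by
        rw [hval (hF 1)]
        refine mul_ne_zero (pow_ne_zero _ (inv_ne_zero hv0)) (RatFunc.algebraMap_ne_zero fun h => ?_)
        exact hF1 (dehomogenize_eq_zero ((hF 1).aeval u hu) h)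
      rw [eq_div_of_mul_eq hF1' hXX]
      exact div_mem (hmem _) (hmem _)
    rw [eq_top_iff, ← RatFunc.IntermediateField.adjoin_X K⟮w⟯, adjoin_simple_le_iff]
    exact hX

/-- A birational parameterization of a curve of degree `d` has degree at most `d`. -/
theorem IsParameterizableBy.degree_le {E : MvPolynomial (Fin 3) K} {d n e : ℕ}
    {F : Fin 2 → MvPolynomial (Fin 3) K} {u : Fin 3 → MvPolynomial (Fin 2) K}
    (h : IsParameterizableBy E e F u) (hd : d ≠ 0) (hE : E.IsHomogeneous d) (hE0 : E ≠ 0)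
    (hu : ∀ i, (u i).IsHomogeneous n) : n ≤ d := by
  have hKinf : Infinite K := IsAlgClosed.instInfinite
  have hc : ∀ t : Fin 2 → K, t ≠ 0 → ∃ i, eval t (u i) ≠ 0 :=
    fun t ht => exists_eval_ne_zero hu h.u_coprime ht
  obtain ⟨i, hi⟩ := hc ![1, 0] (by simp)
  -- Permuting the coordinates makes the first component of u nonzero.
  let π := Equiv.swap 0 i
  have hren : ∀ G : MvPolynomial (Fin 3) K, aeval (u ∘ π) (rename π G) = aeval u G := by
    intro G
    rw [aeval_rename]
    congr 2
    funext j
    simp [π]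
  refine degree_le_of_ne_zero (E := rename π E) (F := fun j => rename π (F j)) (u := u ∘ π)
    (e := e) hE.rename_isHomogeneous ?_ (fun j => hu _) ?_ ?_
    (fun j => (h.F_homogeneous j).rename_isHomogeneous) ?_ ?_ ?_
  · rw [Ne, map_eq_zero_iff _ (rename_injective _ π.injective)]; exact hE0
  · intro t ht
    obtain ⟨j, hj⟩ := hc t ht
    exact ⟨π j, by simpa [π] using hj⟩
  · rw [hren]; exact h.aeval_eq_zero ⟨d, hd, hE⟩
  · rw [hren, hren]; exact h.X_mul_aeval
  · rw [hren]; exact h.aeval_F_ne_zero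
  · intro h0
    have : u i = 0 := by simpa [π] using h0
    exact hi (by rw [this, map_zero])

end Degree

/-! ### The dimension of the space of binary forms -/

section BinaryForms

variable (K : Type*) [Field K]

/-- The coefficients of a binary form. -/
def formCoeffs (m : ℕ) : homogeneousSubmodule (Fin 2) K m →ₗ[K] (Fin (m + 1) → K) :=
  LinearMap.pi fun i =>
    (lcoeff K (Finsupp.equivFunOnFinite.symm ![(i : ℕ), m - i])).comp (Submodule.subtype _)

theorem formCoeffs_bijective (m : ℕ) : Function.Bijective (formCoeffs K m) := by
  have happ : ∀ (f : homogeneousSubmodule (Fin 2) K m) (i : Fin (m + 1)),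
      formCoeffs K m f i =
        coeff (Finsupp.equivFunOnFinite.symm ![(i : ℕ), m - i]) (f : MvPolynomial (Fin 2) K) :=
    fun f i => rfl
  constructor
  · rw [injective_iff_map_eq_zero]
    intro f hf
    ext d
    rw [ZeroMemClass.coe_zero, coeff_zero]
    by_contra hd
    have hdeg : d 0 + d 1 = m := by
      have : d.degree = m := by
        rw [Finsupp.degree_eq_weight_one]
        exact f.2 hd
      rwa [Finsupp.degree_eq_sum, Fin.sum_univ_two] at this
    have h0 := congrFun hf ⟨d 0, by omega⟩
    rw [happ, Pi.zero_apply] at h0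
    have hdd : Finsupp.equivFunOnFinite.symm ![d 0, m - d 0] = d := by
      ext j
      fin_cases j
      · simp
      · simp; omega
    rw [hdd] at h0
    exact hd h0
  · intro c
    refine ⟨⟨∑ i : Fin (m + 1), monomial (Finsupp.equivFunOnFinite.symm ![(i : ℕ), m - i]) (c i), ?_⟩, ?_⟩
    · refine IsHomogeneous.sum _ _ _ fun i _ => isHomogeneous_monomial _ ?_
      rw [Finsupp.degree_eq_sum, Fin.sum_univ_two]
      simp; omega
    · funext i
      rw [happ]
      simp only [coeff_sum]
      rw [Finset.sum_eq_single i]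
      · simp
      · intro j _ hj
        rw [coeff_monomial, if_neg]
        intro h
        have := DFunLike.congr_fun h 0
        simp only [Finsupp.equivFunOnFinite_symm_apply_apply, Matrix.cons_val_zero] at this
        exact hj (Fin.ext this)
      · simp

instance (m : ℕ) : FiniteDimensional K (homogeneousSubmodule (Fin 2) K m) :=
  (LinearEquiv.ofBijective _ (formCoeffs_bijective K m)).symm.finiteDimensional

theorem finrank_homogeneousSubmodule (m : ℕ) :
    Module.finrank K (homogeneousSubmodule (Fin 2) K m) = m + 1 := by
  rw [(LinearEquiv.ofBijective _ (formCoeffs_bijective K m)).finrank_eq, Module.finrank_fin_fun]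

end BinaryForms

/-! ### Syzygies under T ↦ F(X), and the equality deg u = 2k + 1 -/

section Syzygies

variable {K : Type*} [Field K]

/-- The polynomial `∑ s_i(T) X_i`. -/
def ofVec (s : Fin 3 → MvPolynomial (Fin 2) K) : BiPoly K := ∑ i, C (s i) * X i

theorem ofVec_isHomogeneous (s : Fin 3 → MvPolynomial (Fin 2) K) : (ofVec s).IsHomogeneous 1 :=
  IsHomogeneous.sum _ _ _ fun i _ => isHomogeneous_C_mul_X (s i) i

theorem coeff_ofVec (s : Fin 3 → MvPolynomial (Fin 2) K) (i : Fin 3) :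
    coeff (Finsupp.single i 1) (ofVec s) = s i := by
  classical
  simp [ofVec, coeff_sum, coeff_C_mul, coeff_X, Finsupp.single_left_inj]

theorem ofVec_injective : Function.Injective (ofVec (K := K)) := fun s t h =>
  funext fun i => by rw [← coeff_ofVec s, h, coeff_ofVec]

theorem eq_ofVec {P : BiPoly K} (hP : P.IsHomogeneous 1) :
    P = ofVec fun i => coeff (Finsupp.single i 1) P := by
  classical
  ext1 m
  by_cases hm : m.degree = 1
  · obtain ⟨i, rfl⟩ : m ∈ Set.range fun i : Fin 3 => Finsupp.single i 1 := by
      rw [Finsupp.range_single_one]; exact hm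
    rw [coeff_ofVec]
  · rw [hP.coeff_eq_zero hm, (ofVec_isHomogeneous _).coeff_eq_zero hm]

theorem aeval_ofVec (u s : Fin 3 → MvPolynomial (Fin 2) K) :
    aeval u (ofVec s) = ∑ i, s i * u i := by
  simp [ofVec]

theorem ofVec_mem_iff {u s : Fin 3 → MvPolynomial (Fin 2) K} :
    ofVec s ∈ reesIdeal u ↔ ∑ i, s i * u i = 0 := by
  rw [mem_reesIdeal_iff_of_isHomogeneous u (ofVec_isHomogeneous s), aeval_ofVec]

theorem ofVec_isBihomogeneous {s : Fin 3 → MvPolynomial (Fin 2) K} {m : ℕ}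
    (hs : ∀ i, (s i).IsHomogeneous m) : IsBihomogeneous (ofVec s) m 1 := by
  refine ⟨ofVec_isHomogeneous s, fun d => ?_⟩
  classical
  simp only [ofVec, coeff_sum, coeff_C_mul, coeff_X]
  refine IsHomogeneous.sum _ _ _ fun i _ => ?_
  split_ifs
  · simpa using hs i
  · simpa using isHomogeneous_zero _ _ _

theorem eval_swap_ofVec (F : Fin 2 → MvPolynomial (Fin 3) K)
    (s : Fin 3 → MvPolynomial (Fin 2) K) :
    eval F (swap (ofVec s)) = ∑ i, aeval F (s i) * X i := by
  simp only [ofVec, map_sum, map_mul, swap_C, commAlgEquiv_X, eval_C, eval_map]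
  rfl

theorem eval_swap_isHomogeneous {F : Fin 2 → MvPolynomial (Fin 3) K} {e : ℕ}
    (hF : ∀ i, (F i).IsHomogeneous e) {s : Fin 3 → MvPolynomial (Fin 2) K} {m : ℕ}
    (hs : ∀ i, (s i).IsHomogeneous m) :
    (eval F (swap (ofVec s))).IsHomogeneous (e * m + 1) := by
  rw [eval_swap_ofVec]
  exact IsHomogeneous.sum _ _ _ fun i _ => ((hs i).aeval F hF).mul (isHomogeneous_X _ i)

theorem swap_pencil (F : Fin 2 → MvPolynomial (Fin 3) K) :
    swap (varT 0 * ofX (F 1) - varT 1 * ofX (F 0)) = pencil F := by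
  rw [map_sub, map_mul, map_mul, swap_varT, swap_varT, swap_ofX, swap_ofX, pencil]

theorem ofX_isHomogeneous {G : MvPolynomial (Fin 3) K} {m : ℕ} (hG : G.IsHomogeneous m) :
    (ofX G).IsHomogeneous m := hG.map _

theorem biPencil_isHomogeneous {F : Fin 2 → MvPolynomial (Fin 3) K} {e : ℕ}
    (hF : ∀ i, (F i).IsHomogeneous e) :
    (varT 0 * ofX (F 1) - varT 1 * ofX (F 0)).IsHomogeneous e :=
  ((ofX_isHomogeneous (hF 1)).C_mul _).sub ((ofX_isHomogeneous (hF 0)).C_mul _)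

/-- A nonzero form of degree one in `X` does not vanish under `T ↦ F(X)`. -/
theorem eval_swap_ofVec_ne_zero {F : Fin 2 → MvPolynomial (Fin 3) K} {e : ℕ} (he : 1 < e)
    (hF : ∀ i, (F i).IsHomogeneous e) (hcop : IsRelPrime (F 0) (F 1)) (h0 : F 0 ≠ 0)
    {s : Fin 3 → MvPolynomial (Fin 2) K} {m : ℕ} (hs : ∀ i, (s i).IsHomogeneous m)
    (hne : s ≠ 0) : eval F (swap (ofVec s)) ≠ 0 := by
  intro h
  have hsw := swap_isHomogeneous_iff.mpr (ofVec_isBihomogeneous hs).2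
  -- Vanishing would make the form a multiple of the pencil, whose degree in X is e > 1.
  obtain ⟨r, hr⟩ := pencil_dvd_of_eval_eq_zero hcop h0 hsw h
  have hr' : ofVec s = swap.symm r * (varT 0 * ofX (F 1) - varT 1 * ofX (F 0)) := by
    apply swap.injective
    rw [hr, map_mul, swap_pencil, AlgEquiv.apply_symm_apply, mul_comm]
  have h1 := homogeneousComponent_eq_self (ofVec_isHomogeneous s)
  rw [hr', homogeneousComponent_mul_of_not_le (biPencil_isHomogeneous hF) _ (by omega),
    ← hr'] at h1
  refine hne (ofVec_injective ?_)
  rw [← h1]; simp [ofVec]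

variable {E : MvPolynomial (Fin 3) K} {e : ℕ} {F : Fin 2 → MvPolynomial (Fin 3) K}
  {u : Fin 3 → MvPolynomial (Fin 2) K}

theorem IsParameterizableBy.biPencil_mem [Infinite K] (h : IsParameterizableBy E e F u) :
    varT 0 * ofX (F 1) - varT 1 * ofX (F 0) ∈ reesIdeal u := by
  rw [mem_reesIdeal_iff_of_isHomogeneous u (biPencil_isHomogeneous h.F_homogeneous), map_sub,
    map_mul, map_mul, aeval_ofX, aeval_ofX, varT, varT, aeval_C, aeval_C]
  simp only [Algebra.algebraMap_self, RingHom.id_apply, h.X_mul_aeval, sub_self]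

/-- Modulo the pencil, T₁^m f(F(X), X) equals F₁^m f; the Rees ideal is prime and does not contain
T₁. -/
theorem IsParameterizableBy.ofX_eval_mem [Infinite K] (h : IsParameterizableBy E e F u)
    {f : BiPoly K} (hf : f ∈ reesIdeal u) {m : ℕ} (hfm : (swap f).IsHomogeneous m) :
    ofX (eval F (swap f)) ∈ reesIdeal u := by
  obtain ⟨r, hr⟩ := pencil_dvd F hfm 0
  have hr' : varT 0 ^ m * ofX (eval F (swap f)) =
      ofX (F 0) ^ m * f + swap.symm r * (varT 0 * ofX (F 1) - varT 1 * ofX (F 0)) := by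
    apply swap.injective
    rw [map_add, map_mul, map_mul, map_mul, map_pow, map_pow, swap_varT, swap_ofX, swap_ofX,
      swap_pencil, AlgEquiv.apply_symm_apply]
    linear_combination hr
  have hmem : varT 0 ^ m * ofX (eval F (swap f)) ∈ reesIdeal u := by
    rw [hr']
    exact add_mem (Ideal.mul_mem_left _ _ hf) (Ideal.mul_mem_left _ _ h.biPencil_mem)
  exact ((reesIdeal_isPrime u).mem_or_mem hmem).resolve_left fun h0 =>
    varT_notMem_reesIdeal u 0 ((reesIdeal_isPrime u).mem_of_pow_mem _ h0)

theorem IsParameterizableBy.dvd_eval [IsAlgClosed K] (h : IsParameterizableBy E e F u)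
    (hE : Irreducible E) {f : BiPoly K} (hf : f ∈ reesIdeal u) {m : ℕ}
    (hfm : (swap f).IsHomogeneous m) : E ∣ eval F (swap f) :=
  have : Infinite K := IsAlgClosed.instInfinite
  h.dvd_of_ofX_mem hE (h.ofX_eval_mem hf hfm)

/-- Substituting T ↦ F(X) turns the syzygy into a nonzero multiple of E of degree em + 1. -/
theorem IsParameterizableBy.degree_le_of_syzygy [IsAlgClosed K] (h : IsParameterizableBy E e F u)
    (he : 1 < e) (hE : Irreducible E) {d : ℕ} (hd : E.IsHomogeneous d)
    {s : Fin 3 → MvPolynomial (Fin 2) K} {m : ℕ} (hs : ∀ i, (s i).IsHomogeneous m)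
    (hsu : ∑ i, s i * u i = 0) (hne : s ≠ 0) : d ≤ e * m + 1 := by
  have h0 := h.F_zero_ne_zero (by omega)
  have hG := eval_swap_ofVec_ne_zero he h.F_homogeneous h.F_coprime h0 hs hne
  have hdvd := h.dvd_eval hE (ofVec_mem_iff.mpr hsu)
    (swap_isHomogeneous_iff.mpr (ofVec_isBihomogeneous hs).2)
  rw [← hd.totalDegree hE.ne_zero,
    ← (eval_swap_isHomogeneous h.F_homogeneous hs).totalDegree hG]
  obtain ⟨r, hr⟩ := hdvd
  rw [hr] at hG ⊢
  rw [totalDegree_mul_of_isDomain (left_ne_zero_of_mul hG) (right_ne_zero_of_mul hG)]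
  omega

theorem eq_C_mul_of_dvd {σ : Type*} {G G' : MvPolynomial σ K} {d : ℕ} (hG : G.IsHomogeneous d)
    (hG' : G'.IsHomogeneous d) (h : G ∣ G') : ∃ c : K, G' = C c * G := by
  obtain ⟨r, rfl⟩ := h
  by_cases hne : G * r = 0
  · exact ⟨0, by simp [hne]⟩
  have h1 := hG'.totalDegree hne
  rw [totalDegree_mul_of_isDomain (left_ne_zero_of_mul hne) (right_ne_zero_of_mul hne),
    hG.totalDegree (left_ne_zero_of_mul hne)] at h1
  refine ⟨coeff 0 r, ?_⟩
  rw [← totalDegree_eq_zero_iff_eq_C.mp (by omega : r.totalDegree = 0), mul_comm]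

/-- The map sending a triple of forms of degree `m` to `∑ s_i u_i`. -/
def syzMap {n : ℕ} (hu : ∀ i, (u i).IsHomogeneous n) (m : ℕ) :
    (Fin 3 → homogeneousSubmodule (Fin 2) K m) →ₗ[K] homogeneousSubmodule (Fin 2) K (m + n) where
  toFun s := ⟨∑ i, (s i : MvPolynomial (Fin 2) K) * u i,
    sum_mem fun i _ => IsHomogeneous.mul (s i).2 (hu i)⟩
  map_add' s t := by ext1; simp [add_mul, Finset.sum_add_distrib]
  map_smul' c s := by ext1; simp [Finset.smul_sum]

/-- Rank–nullity: 3(m + 1) − (m + n + 1) = 2m + 2 − n. -/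
theorem le_finrank_ker_syzMap {n : ℕ} (hu : ∀ i, (u i).IsHomogeneous n) (m : ℕ) :
    2 * m + 2 ≤ Module.finrank K (LinearMap.ker (syzMap hu m)) + n := by
  have h1 := LinearMap.finrank_range_add_finrank_ker (syzMap hu m)
  have h2 := Submodule.finrank_le (LinearMap.range (syzMap hu m))
  rw [Module.finrank_pi_fintype] at h1
  simp only [finrank_homogeneousSubmodule, Finset.sum_const, Finset.card_univ, Fintype.card_fin,
    smul_eq_mul] at h1 h2
  omega

theorem mem_ker_syzMap {n : ℕ} (hu : ∀ i, (u i).IsHomogeneous n) {m : ℕ}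
    (s : LinearMap.ker (syzMap hu m)) : ∑ i, (s.1 i : MvPolynomial (Fin 2) K) * u i = 0 :=
  congrArg Subtype.val s.2

/-- T ↦ F(X) is injective on syzygies of degree k, and its values are forms of degree 2k + 1
divisible by E, that is, scalar multiples of E. -/
theorem finrank_ker_syzMap_le [IsAlgClosed K] (h : IsParameterizableBy E 2 F u)
    (hE : Irreducible E) {k : ℕ} (hd : E.IsHomogeneous (2 * k + 1)) {n : ℕ}
    (hu : ∀ i, (u i).IsHomogeneous n) :
    Module.finrank K (LinearMap.ker (syzMap hu k)) ≤ 1 := by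
  let Φ : (LinearMap.ker (syzMap hu k)) →ₗ[K] MvPolynomial (Fin 3) K :=
    { toFun := fun s => ∑ i, aeval F (s.1 i : MvPolynomial (Fin 2) K) * X i
      map_add' := fun s t => by simp [add_mul, Finset.sum_add_distrib]
      map_smul' := fun c s => by simp [Finset.smul_sum] }
  have hΦ : ∀ s : LinearMap.ker (syzMap hu k),
      Φ s = eval F (swap (ofVec fun i => (s.1 i : MvPolynomial (Fin 2) K))) :=
    fun s => by rw [eval_swap_ofVec]; rfl
  have hinj : Function.Injective Φ := by
    rw [injective_iff_map_eq_zero]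
    intro s hs
    by_contra hne
    refine eval_swap_ofVec_ne_zero (s := fun i => (s.1 i : MvPolynomial (Fin 2) K))
      one_lt_two h.F_homogeneous h.F_coprime
      (h.F_zero_ne_zero two_ne_zero) (fun i => (s.1 i).2) ?_ ((hΦ s).symm.trans hs)
    intro h0
    refine hne ?_
    ext i : 3
    exact congrFun h0 i
  have hrange : LinearMap.range Φ ≤ Submodule.span K {E} := by
    rintro _ ⟨s, rfl⟩
    have hsh : ∀ i, (s.1 i : MvPolynomial (Fin 2) K).IsHomogeneous k := fun i => (s.1 i).2
    obtain ⟨c, hc⟩ := eq_C_mul_of_dvd hd (eval_swap_isHomogeneous h.F_homogeneous hsh)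
      (h.dvd_eval hE (ofVec_mem_iff.mpr (mem_ker_syzMap hu s))
        (swap_isHomogeneous_iff.mpr (ofVec_isBihomogeneous hsh).2))
    rw [hΦ, hc, ← smul_eq_C_mul]
    exact Submodule.smul_mem _ _ (Submodule.mem_span_singleton_self E)
  rw [← LinearMap.finrank_range_of_inj hinj]
  exact (Submodule.finrank_mono hrange).trans (finrank_span_singleton hE.ne_zero).le

/-- The degree of the parameterization induced by a pair of conics is the degree of the curve. -/
theorem IsParameterizableBy.isHomogeneous_of_conics [IsAlgClosed K]
    (h : IsParameterizableBy E 2 F u) (hE : Irreducible E) {k : ℕ}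
    (hd : E.IsHomogeneous (2 * k + 1)) (i : Fin 3) : (u i).IsHomogeneous (2 * k + 1) := by
  obtain ⟨n, hu⟩ := h.u_homogeneous
  -- `h1` gives n ≤ 2k + 1; `h2` and `h3` together give 2k + 2 ≤ 1 + n.
  have h1 := h.degree_le (by omega) hd hE.ne_zero hu
  have h2 := le_finrank_ker_syzMap hu k
  have h3 := finrank_ker_syzMap_le h hE hd hu
  obtain rfl : n = 2 * k + 1 := by omega
  exact hu i

end Syzygies

/-! ### Primitive and parallel vectors over a factorial domain -/

section CrossProduct

variable {R : Type*} [CommRing R] [IsDomain R] [UniqueFactorizationMonoid R]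

theorem dvd_of_forall_dvd_mul {ι : Type*} {v : ι → R}
    (hv : ∀ g, (∀ i, g ∣ v i) → IsUnit g) {a b : R} (h : ∀ i, b ∣ a * v i) : b ∣ a := by
  induction b using UniqueFactorizationMonoid.induction_on_prime generalizing a with
  | h₁ =>
    by_contra ha
    refine not_isUnit_zero (hv 0 fun i => ?_)
    have := zero_dvd_iff.mp (h i)
    rcases mul_eq_zero.mp this with h' | h'
    · exact absurd (zero_dvd_iff.mpr h') ha
    · exact zero_dvd_iff.mpr h'
  | h₂ x hx => exact hx.dvd
  | h₃ x p hx hp ih =>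
    have hpa : p ∣ a := by
      by_contra hpa
      exact hp.not_isUnit (hv p fun i =>
        (hp.dvd_or_dvd ((dvd_mul_right p x).trans (h i))).resolve_left hpa)
    obtain ⟨a', rfl⟩ := hpa
    refine mul_dvd_mul_left p (ih fun i => ?_)
    have := h i
    rw [mul_assoc] at this
    exact (mul_dvd_mul_iff_left hp.ne_zero).mp this

/-- A vector that is parallel to a primitive vector is a multiple of it. -/
theorem exists_eq_mul_of_parallel {ι : Type*} {v w : ι → R}
    (hv : ∀ g, (∀ i, g ∣ v i) → IsUnit g) (h : ∀ i j, w i * v j = w j * v i) :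
    ∃ a, ∀ i, w i = a * v i := by
  obtain ⟨i, hi⟩ : ∃ i, v i ≠ 0 := by
    by_contra! h0
    exact not_isUnit_zero (hv 0 fun i => zero_dvd_iff.mpr (h0 i))
  obtain ⟨a, ha⟩ := dvd_of_forall_dvd_mul hv (a := w i) (b := v i)
    fun j => ⟨w j, by rw [h i j, mul_comm]⟩
  refine ⟨a, fun j => mul_right_cancel₀ hi ?_⟩
  rw [h j i, ha]; ring

omit [IsDomain R] [UniqueFactorizationMonoid R] in
-- Both p × q and u are orthogonal to p and q.
theorem cross_parallel {u p q : Fin 3 → R} (hp : ∑ i, p i * u i = 0) (hq : ∑ i, q i * u i = 0)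
    (i j : Fin 3) : crossProduct p q i * u j = crossProduct p q j * u i := by
  rw [Fin.sum_univ_three] at hp hq
  fin_cases i <;> fin_cases j <;> simp [cross_apply]
  · linear_combination q 2 * hp - p 2 * hq
  · linear_combination p 1 * hq - q 1 * hp
  · linear_combination p 2 * hq - q 2 * hp
  · linear_combination q 0 * hp - p 0 * hq
  · linear_combination q 1 * hp - p 1 * hq
  · linear_combination p 0 * hq - q 0 * hp

end CrossProduct

/-! ### Cross product identities -/

section CrossIdentities

variable {R : Type*} [CommRing R]

/-- Cramer's rule for expressing s through p and q. Off the diagonal it is an identity; for i = j it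
needs det(s, p, q) = 0. -/
theorem cross_expansion {s p q : Fin 3 → R} (h : ∑ i, s i * crossProduct p q i = 0)
    (i j : Fin 3) : s j * crossProduct p q i =
      p j * crossProduct s q i - q j * crossProduct s p i := by
  rw [Fin.sum_univ_three] at h
  simp only [cross_apply, Matrix.cons_val_zero, Matrix.cons_val_one, Matrix.cons_val] at h
  fin_cases i <;> fin_cases j <;> simp [cross_apply]
  · linear_combination h
  · ring
  · ring
  · ring
  · linear_combination h
  · ring
  · ring
  · ring
  · linear_combination h

theorem mul_eq_mul_of_cross_eq_zero {p q : Fin 3 → R} (h : ∀ i, crossProduct p q i = 0)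
    (i j : Fin 3) : p i * q j = p j * q i := by
  have h0 := h 0
  have h1 := h 1
  have h2 := h 2
  simp only [cross_apply, Matrix.cons_val_zero, Matrix.cons_val_one, Matrix.cons_val] at h0 h1 h2
  fin_cases i <;> fin_cases j <;> simp
  · linear_combination h2
  · linear_combination -h1
  · linear_combination -h2
  · linear_combination h0
  · linear_combination h1
  · linear_combination -h0

end CrossIdentities

/-! ### Existence and characterization of μ-bases -/

section MuBasis

variable {K : Type*} [Field K] {E : MvPolynomial (Fin 3) K} {e k : ℕ}
  {F : Fin 2 → MvPolynomial (Fin 3) K} {u : Fin 3 → MvPolynomial (Fin 2) K}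

theorem cross_isHomogeneous {p q : Fin 3 → MvPolynomial (Fin 2) K} {m n : ℕ}
    (hp : ∀ i, (p i).IsHomogeneous m) (hq : ∀ i, (q i).IsHomogeneous n) (i : Fin 3) :
    (crossProduct p q i).IsHomogeneous (m + n) := by
  rw [cross_apply]
  fin_cases i
  · exact ((hp 1).mul (hq 2)).sub ((hp 2).mul (hq 1))
  · exact ((hp 2).mul (hq 0)).sub ((hp 0).mul (hq 2))
  · exact ((hp 0).mul (hq 1)).sub ((hp 1).mul (hq 0))

/-- p × q is a multiple of the primitive vector u, and both have degree m + n, so the factor is a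
constant. -/
theorem exists_cross_eq {p q : Fin 3 → MvPolynomial (Fin 2) K} {m n : ℕ}
    (hu : ∀ i, (u i).IsHomogeneous (m + n))
    (huc : ∀ g : MvPolynomial (Fin 2) K, (∀ i, g ∣ u i) → IsUnit g)
    (hp : ∀ i, (p i).IsHomogeneous m) (hq : ∀ i, (q i).IsHomogeneous n)
    (hpu : ∑ i, p i * u i = 0) (hqu : ∑ i, q i * u i = 0) :
    ∃ c : K, ∀ i, crossProduct p q i = C c * u i := by
  obtain ⟨a, ha⟩ := exists_eq_mul_of_parallel huc (cross_parallel hpu hqu)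
  obtain ⟨i, hi⟩ : ∃ i, u i ≠ 0 := by
    by_contra! h0
    exact not_isUnit_zero (huc 0 fun i => zero_dvd_iff.mpr (h0 i))
  obtain ⟨c, hc⟩ := eq_C_mul_of_dvd (hu i) (cross_isHomogeneous hp hq i)
    (ha i ▸ dvd_mul_left _ _)
  refine ⟨c, fun j => ?_⟩
  rw [ha j, mul_right_cancel₀ hi ((ha i).symm.trans hc)]

theorem ofVec_smul_add_smul (a b : MvPolynomial (Fin 2) K)
    (s t : Fin 3 → MvPolynomial (Fin 2) K) :
    a • ofVec s + b • ofVec t = ofVec fun i => a * s i + b * t i := by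
  simp only [ofVec, smul_eq_C_mul, Finset.mul_sum, ← Finset.sum_add_distrib, map_add, map_mul]
  exact Finset.sum_congr rfl fun i _ => by ring

theorem ofVec_zero : ofVec (0 : Fin 3 → MvPolynomial (Fin 2) K) = 0 := by simp [ofVec]

theorem mem_syzModule_iff {P : BiPoly K} :
    P ∈ syzModule u ↔ P ∈ reesIdeal u ∧ P.IsHomogeneous 1 := Iff.rfl

/-- For a syzygy s write s × p = αu and s × q = βu; `cross_expansion` then gives cs = βp − αq. -/
theorem isMuBasis_ofVec {p q : Fin 3 → MvPolynomial (Fin 2) K} {m n : ℕ}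
    (huc : ∀ g : MvPolynomial (Fin 2) K, (∀ i, g ∣ u i) → IsUnit g)
    (hp : ∀ i, (p i).IsHomogeneous m) (hq : ∀ i, (q i).IsHomogeneous n)
    (hpu : ∑ i, p i * u i = 0) (hqu : ∑ i, q i * u i = 0) {c : K} (hc : c ≠ 0)
    (hcross : ∀ i, crossProduct p q i = C c * u i) : IsMuBasis u m n (ofVec p) (ofVec q) := by
  obtain ⟨l, hl⟩ : ∃ i, u i ≠ 0 := by
    by_contra! h0
    exact not_isUnit_zero (huc 0 fun i => zero_dvd_iff.mpr (h0 i))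
  have hcl : crossProduct p q l ≠ 0 := by
    rw [hcross]; exact mul_ne_zero (by simpa using hc) hl
  refine ⟨ofVec_isBihomogeneous hp, ofVec_isBihomogeneous hq, ?_, le_antisymm ?_ ?_⟩
  · rw [LinearIndependent.pair_iff]
    intro a b hab
    rw [ofVec_smul_add_smul, ← ofVec_zero] at hab
    have hab := fun i => congrFun (ofVec_injective hab) i
    simp only [Pi.zero_apply] at hab
    have h0 := hab 0
    have h1 := hab 1
    have h2 := hab 2
    have key : ∀ i, a * crossProduct p q i = 0 ∧ b * crossProduct p q i = 0 := by
      intro i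
      rw [cross_apply]
      fin_cases i <;> simp [-mul_eq_zero] <;> constructor
      · linear_combination q 2 * h1 - q 1 * h2
      · linear_combination p 1 * h2 - p 2 * h1
      · linear_combination q 0 * h2 - q 2 * h0
      · linear_combination p 2 * h0 - p 0 * h2
      · linear_combination q 1 * h0 - q 0 * h1
      · linear_combination p 0 * h1 - p 1 * h0
    exact ⟨(mul_eq_zero.mp (key l).1).resolve_right hcl,
      (mul_eq_zero.mp (key l).2).resolve_right hcl⟩
  · rw [Submodule.span_le]
    rintro _ (rfl | rfl)
    · exact ⟨ofVec_mem_iff.mpr hpu, ofVec_isHomogeneous _⟩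
    · exact ⟨ofVec_mem_iff.mpr hqu, ofVec_isHomogeneous _⟩
  · intro P hP
    obtain ⟨hPu, hP1⟩ := mem_syzModule_iff.mp hP
    rw [eq_ofVec hP1] at hPu ⊢
    set s := fun i => coeff (Finsupp.single i 1) P
    have hsu := ofVec_mem_iff.mp hPu
    obtain ⟨α, hα⟩ := exists_eq_mul_of_parallel huc (cross_parallel hsu hpu)
    obtain ⟨β, hβ⟩ := exists_eq_mul_of_parallel huc (cross_parallel hsu hqu)
    have hdet : ∑ i, s i * crossProduct p q i = 0 := by
      have : ∑ i, s i * crossProduct p q i = C c * ∑ i, s i * u i := by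
        rw [Finset.mul_sum]
        exact Finset.sum_congr rfl fun i _ => by rw [hcross]; ring
      rw [this, hsu, mul_zero]
    have hCc : (C c⁻¹ * C c : MvPolynomial (Fin 2) K) = 1 := by
      rw [← C_mul, inv_mul_cancel₀ hc, C_1]
    rw [Submodule.mem_span_pair]
    refine ⟨C c⁻¹ * β, -(C c⁻¹ * α), ?_⟩
    rw [ofVec_smul_add_smul]
    congr 1
    funext j
    have hj := cross_expansion hdet l j
    rw [hcross, hα, hβ] at hj
    apply mul_right_cancel₀ hl
    linear_combination -C c⁻¹ * hj + s j * u l * hCc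

theorem IsMuBasis.exists_ofVec {P Q : BiPoly K} {m n : ℕ} (h : IsMuBasis u m n P Q)
    (hu : ∀ i, (u i).IsHomogeneous (m + n))
    (huc : ∀ g : MvPolynomial (Fin 2) K, (∀ i, g ∣ u i) → IsUnit g) :
    ∃ p q : Fin 3 → MvPolynomial (Fin 2) K, P = ofVec p ∧ Q = ofVec q ∧
      (∀ i, (p i).IsHomogeneous m) ∧ (∀ i, (q i).IsHomogeneous n) ∧
      ∑ i, p i * u i = 0 ∧ ∑ i, q i * u i = 0 ∧
      ∃ c : K, c ≠ 0 ∧ ∀ i, crossProduct p q i = C c * u i := by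
  obtain ⟨p, rfl⟩ : ∃ p, P = ofVec p := ⟨_, eq_ofVec h.bihomogeneous_p.1⟩
  obtain ⟨q, rfl⟩ : ∃ q, Q = ofVec q := ⟨_, eq_ofVec h.bihomogeneous_q.1⟩
  have hp : ∀ i, (p i).IsHomogeneous m := fun i => coeff_ofVec p i ▸ h.bihomogeneous_p.2 _
  have hq : ∀ i, (q i).IsHomogeneous n := fun i => coeff_ofVec q i ▸ h.bihomogeneous_q.2 _
  have hpu : ∑ i, p i * u i = 0 := by
    have : ofVec p ∈ syzModule u := h.span_eq ▸ Submodule.subset_span (by simp)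
    exact ofVec_mem_iff.mp this.1
  have hqu : ∑ i, q i * u i = 0 := by
    have : ofVec q ∈ syzModule u := h.span_eq ▸ Submodule.subset_span (by simp)
    exact ofVec_mem_iff.mp this.1
  obtain ⟨c, hc⟩ := exists_cross_eq hu huc hp hq hpu hqu
  refine ⟨p, q, rfl, rfl, hp, hq, hpu, hqu, c, ?_, hc⟩
  rintro rfl
  have hpar := mul_eq_mul_of_cross_eq_zero (p := p) (q := q) fun i => by rw [hc i, C_0, zero_mul]
  have hli := LinearIndependent.pair_iff.mp h.linearIndependent
  have hp0 : ∀ i, p i = 0 := by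
    intro i
    refine neg_eq_zero.mp (hli (q i) (-p i) ?_).2
    rw [ofVec_smul_add_smul, ← ofVec_zero]
    congr 1
    funext j
    simp only [Pi.zero_apply]
    linear_combination -hpar i j
  have := (hli 1 0 (by
    rw [ofVec_smul_add_smul, ← ofVec_zero]; congr 1; funext j; simp [hp0 j])).1
  exact one_ne_zero this

theorem exists_isMuBasis [IsAlgClosed K] (h : IsParameterizableBy E 2 F u) (hE : Irreducible E)
    (hd : E.IsHomogeneous (2 * k + 1)) : ∃ p q : BiPoly K, IsMuBasis u k (k + 1) p q := by
  have hu : ∀ i, (u i).IsHomogeneous (2 * k + 1) := h.isHomogeneous_of_conics hE hd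
  have hu' : ∀ i, (u i).IsHomogeneous (k + (k + 1)) := fun i => by
    rw [show k + (k + 1) = 2 * k + 1 by ring]; exact hu i
  -- The count in degree k gives dimension at least 2k + 2 − (2k + 1) = 1.
  obtain ⟨p', hp'⟩ : ∃ s : LinearMap.ker (syzMap hu k), s ≠ 0 := by
    by_contra! hall
    have := le_finrank_ker_syzMap hu k
    have hsub : Subsingleton (LinearMap.ker (syzMap hu k)) :=
      ⟨fun s t => (hall s).trans (hall t).symm⟩
    rw [Module.finrank_zero_of_subsingleton] at this
    omega
  let p : Fin 3 → MvPolynomial (Fin 2) K := fun i => p'.1 i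
  have hp : ∀ i, (p i).IsHomogeneous k := fun i => (p'.1 i).2
  have hpu : ∑ i, p i * u i = 0 := mem_ker_syzMap hu p'
  obtain ⟨j, hj⟩ : ∃ j, p j ≠ 0 := by
    by_contra! h0
    exact hp' (by ext i : 3; exact h0 i)
  -- Dividing p by a common factor g gives a syzygy with a nonzero component of degree at most k −
  -- deg g, whereas `degree_le_of_syzygy` forbids nonzero syzygies of degree below k.
  have hprim : ∀ g, (∀ i, g ∣ p i) → IsUnit g := by
    intro g hg
    choose p₁ hp₁ using hg
    have hg0 : g ≠ 0 := by rintro rfl; exact hj (by rw [hp₁, zero_mul])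
    have hpj : p₁ j ≠ 0 := fun h0 => hj (by rw [hp₁, h0, mul_zero])
    have hp₁u : ∑ i, p₁ i * u i = 0 := by
      apply mul_left_cancel₀ hg0
      rw [mul_zero, ← hpu, Finset.mul_sum]
      exact Finset.sum_congr rfl fun i _ => by rw [hp₁, mul_assoc]
    have hdeg := (hp j).totalDegree hj
    rw [hp₁, totalDegree_mul_of_isDomain hg0 hpj] at hdeg
    obtain ⟨d, hd'⟩ := ne_zero_iff.mp hpj
    have hdle : d.degree ≤ (p₁ j).totalDegree := by
      rw [Finsupp.degree_eq_sum]
      have := le_totalDegree (mem_support_iff.mpr hd')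
      rwa [Finsupp.sum_fintype _ _ fun _ => rfl] at this
    have hk := h.degree_le_of_syzygy one_lt_two hE hd
      (s := fun i => homogeneousComponent d.degree (p₁ i)) (m := d.degree)
      (fun i => homogeneousComponent_isHomogeneous _ _) (by
        have := congrArg (homogeneousComponent (d.degree + (2 * k + 1))) hp₁u
        rw [map_sum, map_zero] at this
        rw [← this]
        refine Finset.sum_congr rfl fun i _ => ?_
        rw [homogeneousComponent_mul_of_le (hu i) _ (by omega), Nat.add_sub_cancel])
      (by
        intro h0
        have := congrArg (coeff d) (congrFun h0 j)
        rw [coeff_homogeneousComponent, if_pos rfl] at this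
        exact hd' this)
    have hgd : g.totalDegree = 0 := by omega
    rw [totalDegree_eq_zero_iff_eq_C.mp hgd] at hg0 ⊢
    exact (IsUnit.mk0 _ fun h0 => hg0 (by rw [h0, C_0])).map C
  let ι : LinearMap.ker (syzMap hu (k + 1)) →ₗ[K] (Fin 3 → MvPolynomial (Fin 2) K) :=
    (LinearMap.pi fun i => (Submodule.subtype _).comp (LinearMap.proj i)).comp
      (Submodule.subtype _)
  have hι : ∀ s i, ι s i = (s.1 i : MvPolynomial (Fin 2) K) := fun s i => rfl
  -- In degree k + 1 the syzygies have dimension at least 3, and T₁p, T₂p span at most 2.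
  obtain ⟨q', hq'⟩ : ∃ s, ι s ∉ Submodule.span K
      (Set.range fun l : Fin 2 => fun i => X l * p i) := by
    by_contra! hall
    have hinj : Function.Injective ι := by
      intro s t hst
      ext i : 3
      exact congrFun hst i
    have h1 := le_finrank_ker_syzMap hu (k + 1)
    have hle : LinearMap.range ι ≤ Submodule.span K
        (Set.range fun l : Fin 2 => fun i => X l * p i) := by
      rintro _ ⟨s, rfl⟩; exact hall s
    have : FiniteDimensional K (Submodule.span K
      (Set.range fun l : Fin 2 => fun i => X l * p i)) :=
      FiniteDimensional.span_of_finite K (Set.finite_range _)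
    have h2 := Submodule.finrank_mono hle
    rw [LinearMap.finrank_range_of_inj hinj] at h2
    have h3 : Module.finrank K (Submodule.span K
      (Set.range fun l : Fin 2 => fun i => X l * p i)) ≤ 2 :=
      (finrank_range_le_card _).trans (by simp)
    omega
  let q : Fin 3 → MvPolynomial (Fin 2) K := fun i => q'.1 i
  have hq : ∀ i, (q i).IsHomogeneous (k + 1) := fun i => (q'.1 i).2
  have hqu : ∑ i, q i * u i = 0 := mem_ker_syzMap hu q'
  obtain ⟨c, hcross⟩ := exists_cross_eq hu' h.u_coprime hp hq hpu hqu
  -- If p × q = 0, then q is a multiple of the primitive p by a linear form, against the choice of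
  -- q.
  have hc : c ≠ 0 := by
    rintro rfl
    have hpar := mul_eq_mul_of_cross_eq_zero (p := p) (q := q)
      fun i => by rw [hcross i, C_0, zero_mul]
    obtain ⟨a, ha⟩ := exists_eq_mul_of_parallel hprim (w := q) fun i l => by
      rw [mul_comm, hpar l i, mul_comm]
    have ha1 : homogeneousComponent 1 a ∈ homogeneousSubmodule (Fin 2) K 1 :=
      homogeneousComponent_mem 1 a
    rw [homogeneousSubmodule_one_eq_span_X, Submodule.mem_span_range_iff_exists_fun] at ha1
    obtain ⟨γ, hγ⟩ := ha1
    refine hq' (Submodule.mem_span_range_iff_exists_fun K |>.mpr ⟨γ, funext fun i => ?_⟩)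
    have h1 : q i = homogeneousComponent 1 a * p i := by
      rw [← homogeneousComponent_eq_self (hq i), ha i,
        homogeneousComponent_mul_of_le (hp i) _ (by omega), Nat.add_sub_cancel_left]
    rw [hι]
    change _ = q i
    rw [h1, ← hγ]
    simp [Fin.sum_univ_two, add_mul]
  exact ⟨_, _, isMuBasis_ofVec h.u_coprime hp hq hpu hqu hc hcross⟩

end MuBasis

/-! ### Koszul relation of two independent linear forms -/

section LinearForms

variable {K : Type*} [Field K]

/-- The linear form with the given coefficients. -/
def linearForm (l : Fin 3 → K) : MvPolynomial (Fin 3) K := ∑ i, C (l i) * X i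

theorem linearForm_isHomogeneous (l : Fin 3 → K) : (linearForm l).IsHomogeneous 1 :=
  IsHomogeneous.sum _ _ _ fun i _ => isHomogeneous_C_mul_X (l i) i

theorem coeff_linearForm (l : Fin 3 → K) (i : Fin 3) :
    coeff (Finsupp.single i 1) (linearForm l) = l i := by
  classical
  simp [linearForm, coeff_sum, coeff_C_mul, coeff_X, Finsupp.single_left_inj]

theorem linearForm_prime {l : Fin 3 → K} (hl : l ≠ 0) : Prime (linearForm l) := by
  have hne : linearForm l ≠ 0 := by
    intro h
    exact hl (funext fun i => by rw [← coeff_linearForm l, h, coeff_zero, Pi.zero_apply])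
  rw [← UniqueFactorizationMonoid.irreducible_iff_prime]
  refine irreducible_of_totalDegree_eq_one ((linearForm_isHomogeneous l).totalDegree hne)
    fun x hx => IsUnit.mk0 _ fun hx0 => ?_
  subst hx0
  exact hne (MvPolynomial.ext _ _ fun m => by rw [coeff_zero]; exact zero_dvd_iff.mp (hx m))

theorem linearForm_syzygy {l l' : Fin 3 → K} (h : crossProduct l l' ≠ 0)
    {x y : MvPolynomial (Fin 3) K} (hxy : x * linearForm l + y * linearForm l' = 0) :
    ∃ s, x = s * linearForm l' ∧ y = -s * linearForm l := by
  have hl : l ≠ 0 := by rintro rfl; simp at h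
  have hprime := linearForm_prime hl
  have hdvd : linearForm l ∣ y * linearForm l' := ⟨-x, by linear_combination hxy⟩
  rcases hprime.dvd_or_dvd hdvd with ⟨s, hs⟩ | hdvd
  · refine ⟨-s, mul_right_cancel₀ hprime.ne_zero ?_, ?_⟩
    · linear_combination hxy - linearForm l' * hs
    · linear_combination hs
  · exfalso
    obtain ⟨c, hc⟩ := eq_C_mul_of_dvd (linearForm_isHomogeneous l) (linearForm_isHomogeneous l')
      hdvd
    have hcl : ∀ i, l' i = c * l i := fun i => by
      rw [← coeff_linearForm l', hc, coeff_C_mul, coeff_linearForm]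
    apply h
    rw [cross_apply]
    funext i
    fin_cases i <;> simp [hcl] <;> ring

end LinearForms

/-! ### Generation of the Rees ideal -/

section Generation

variable {K : Type*} [Field K] {E : MvPolynomial (Fin 3) K} {e k : ℕ}
  {F : Fin 2 → MvPolynomial (Fin 3) K} {u : Fin 3 → MvPolynomial (Fin 2) K}

theorem eval_swap_ofVec_point (t : Fin 2 → K) (s : Fin 3 → MvPolynomial (Fin 2) K) :
    eval (fun i => C (t i)) (swap (ofVec s)) = linearForm fun i => eval t (s i) := by
  simp only [ofVec, map_sum, map_mul, swap_C, commAlgEquiv_X, eval_C, linearForm]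
  refine Finset.sum_congr rfl fun i _ => ?_
  congr 1
  rw [eval_map]
  exact eval₂_comp_left C (RingHom.id K) t (s i) |>.symm

theorem cons_zero_one_eq : (![0, 1] : Fin 2 → MvPolynomial (Fin 3) K) =
    fun i => C ((![0, 1] : Fin 2 → K) i) := by
  funext i; fin_cases i <;> simp

theorem C_mul_X_sub_mem {p q : BiPoly K} {m n : ℕ} (h : IsMuBasis u m n p q) (i j : Fin 3) :
    C (u i) * X j - X i * C (u j) ∈ Ideal.span {p, q} := by
  have hmem : C (u i) * X j - X i * C (u j) ∈ syzModule u := by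
    rw [mem_syzModule_iff]
    have hh : IsHomogeneous (C (u i) * X j - X i * C (u j) : BiPoly K) 1 := by
      rw [mul_comm (X i)]
      exact (isHomogeneous_C_mul_X _ _).sub (isHomogeneous_C_mul_X _ _)
    refine ⟨?_, hh⟩
    rw [mem_reesIdeal_iff_of_isHomogeneous u hh]
    simp
  rw [← h.span_eq, Submodule.mem_span_pair] at hmem
  obtain ⟨a, b, hab⟩ := hmem
  rw [Ideal.mem_span_pair]
  exact ⟨C a, C b, by rw [← hab, smul_eq_C_mul, smul_eq_C_mul]⟩

/-- Modulo (p, q) one has u_iX_l = X_iu_l, so u_i^j f(X) = f(u_iX) is congruent to f(X_iu) = X_i^j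
f(u) = 0. -/
theorem C_pow_mul_mem {p q : BiPoly K} {m n : ℕ} (h : IsMuBasis u m n p q) {f : BiPoly K} {j : ℕ}
    (hf : f.IsHomogeneous j) (hfu : f ∈ reesIdeal u) (i : Fin 3) :
    C (u i ^ j) * f ∈ Ideal.span {p, q} := by
  have h1 : aeval (fun l => C (u i) * (X l : BiPoly K)) f = C (u i ^ j) * f := by
    rw [aeval_mul_of_isHomogeneous hf, aeval_X_left_apply, C_pow]
  have h2 : aeval (fun l => (X i : BiPoly K) * C (u l)) f = 0 := by
    rw [aeval_mul_of_isHomogeneous hf]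
    have h3 := comp_aeval_apply (f := u)
      (Algebra.ofId (MvPolynomial (Fin 2) K) (BiPoly K)) f
    rw [(mem_reesIdeal_iff_of_isHomogeneous u hf).mp hfu, map_zero] at h3
    have h4 : aeval (fun l => (C (u l) : BiPoly K)) f = 0 := h3.symm
    rw [h4, mul_zero]
  have := aeval_sub_aeval_mem (Ideal.span {p, q}) (C_mul_X_sub_mem h i) f
  rwa [h1, h2, sub_zero] at this

/-- The multipliers taking f into (p, q) form an ideal of K[T] containing a power of each u_i, hence
a power of T₁. -/
theorem exists_varT_pow_mul_mem [IsAlgClosed K] {p q : BiPoly K} {m n l : ℕ}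
    (h : IsMuBasis u m n p q) (hu : ∀ i, (u i).IsHomogeneous l)
    (huc : ∀ g : MvPolynomial (Fin 2) K, (∀ i, g ∣ u i) → IsUnit g) {f : BiPoly K} {j : ℕ}
    (hf : f.IsHomogeneous j) (hfu : f ∈ reesIdeal u) :
    ∃ N, varT 0 ^ N * f ∈ Ideal.span {p, q} := by
  let I : Ideal (MvPolynomial (Fin 2) K) :=
    ((Ideal.span {p, q}).restrictScalars (MvPolynomial (Fin 2) K)).comap
      (LinearMap.toSpanSingleton _ _ f)
  have hI : ∀ r, r ∈ I ↔ C r * f ∈ Ideal.span {p, q} := fun r => by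
    rw [← smul_eq_C_mul]; rfl
  have hle : Ideal.span (Set.range u) ≤ I.radical := by
    rw [Ideal.span_le]
    rintro _ ⟨i, rfl⟩
    exact ⟨j, (hI _).mpr (C_pow_mul_mem h hf hfu i)⟩
  obtain ⟨N, hN⟩ := (Ideal.radical_le_radical_iff.mpr hle) (X_zero_mem_radical_span hu huc)
  refine ⟨N, ?_⟩
  rw [varT, ← C_pow]
  exact (hI _).mp hN

/-- The forms of small degree in `T` that vanish on the graph of the parameterization are, up to
multiples of the pencil, multiples of a single one. -/
theorem IsParameterizableBy.exists_eq_add [IsAlgClosed K] (h : IsParameterizableBy E e F u)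
    (he : e ≠ 0) (hE : Irreducible E) {f P : BiPoly K} {i : ℕ} (hf : f ∈ reesIdeal u)
    (hfi : (swap f).IsHomogeneous i) (hP : (swap P).IsHomogeneous i) {c : K} (hc : c ≠ 0)
    (hPE : eval F (swap P) = C c * E) :
    ∃ g r, f = g * P + r * (varT 0 * ofX (F 1) - varT 1 * ofX (F 0)) := by
  obtain ⟨g, hg⟩ := h.dvd_eval hE hf hfi
  have hhom : (swap f - C (C c⁻¹ * g) * swap P).IsHomogeneous i := hfi.sub (hP.C_mul _)
  have hCc : (C c⁻¹ * C c : MvPolynomial (Fin 3) K) = 1 := by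
    rw [← C_mul, inv_mul_cancel₀ hc, C_1]
  obtain ⟨r, hr⟩ := pencil_dvd_of_eval_eq_zero h.F_coprime (h.F_zero_ne_zero he) hhom (by
    rw [map_sub, map_mul, eval_C, hg, hPE]
    linear_combination -E * g * hCc)
  refine ⟨ofX (C c⁻¹ * g), swap.symm r, swap.injective ?_⟩
  rw [map_add, map_mul, map_mul, swap_ofX, swap_pencil, AlgEquiv.apply_symm_apply]
  linear_combination hr

theorem homogeneousComponent_mem_reesIdeal {f : BiPoly K} (hf : f ∈ reesIdeal u) (j : ℕ) :
    homogeneousComponent j f ∈ reesIdeal u := by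
  rw [mem_reesIdeal_iff_of_isHomogeneous u (homogeneousComponent_isHomogeneous j f)]
  exact (mem_reesIdeal_iff u).mp hf j

theorem swap_tComponent_isHomogeneous (i : ℕ) (f : BiPoly K) :
    (swap (tComponent i f)).IsHomogeneous i := by
  rw [tComponent, AlgEquiv.apply_symm_apply]
  exact homogeneousComponent_isHomogeneous i _

theorem tComponent_isHomogeneous {f : BiPoly K} {j : ℕ} (hf : f.IsHomogeneous j) (i : ℕ) :
    (tComponent i f).IsHomogeneous j := by
  rw [← homogeneousComponent_eq_self hf, ← homogeneousComponent_tComponent]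
  exact homogeneousComponent_isHomogeneous j _

theorem IsParameterizableBy.mem_span_of_isMuBasis [IsAlgClosed K]
    (h : IsParameterizableBy E 2 F u) (hE : Irreducible E) (hd : E.IsHomogeneous (2 * k + 1))
    {p q : BiPoly K} (hpq : IsMuBasis u k (k + 1) p q) {c : K} (hc : c ≠ 0)
    (hpE : eval F (swap p) = C c * E) {f : BiPoly K} (hf : f ∈ reesIdeal u) {i j : ℕ}
    (hfj : f.IsHomogeneous j) (hfi : (swap f).IsHomogeneous i) (hi : k ≤ i) :
    f ∈ Ideal.span {p, q, varT 0 * ofX (F 1) - varT 1 * ofX (F 0)} := by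
  have hinf : Infinite K := IsAlgClosed.instInfinite
  have hu : ∀ i, (u i).IsHomogeneous (2 * k + 1) := h.isHomogeneous_of_conics hE hd
  obtain ⟨s, t, rfl, rfl, hs, ht, hsu, htu, c', hc', hcross⟩ := hpq.exists_ofVec
    (fun i => by rw [show k + (k + 1) = 2 * k + 1 by ring]; exact hu i) h.u_coprime
  set Q : BiPoly K := varT 0 * ofX (F 1) - varT 1 * ofX (F 0)
  have hQu : Q ∈ reesIdeal u := h.biPencil_mem
  have hsi := swap_isHomogeneous_iff.mpr (ofVec_isBihomogeneous hs).2
  have hti := swap_isHomogeneous_iff.mpr (ofVec_isBihomogeneous ht).2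
  have hmem : ∀ g : BiPoly K, swap g ∈
      Ideal.span {swap (ofVec s), swap (ofVec t), pencil F} ↔
        g ∈ Ideal.span {ofVec s, ofVec t, Q} := by
    intro g
    have hmap : Ideal.span {swap (ofVec s), swap (ofVec t), pencil F} =
        (Ideal.span {ofVec s, ofVec t, Q}).map (swap : BiPoly K ≃ₐ[K] _).toRingEquiv := by
      rw [Ideal.map_span, Set.image_insert_eq, Set.image_pair, ← swap_pencil]
      rfl
    rw [hmap]
    refine (Ideal.mem_map_of_equiv _ _).trans ⟨?_, fun hg => ⟨g, hg, rfl⟩⟩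
    rintro ⟨x, hx, hxg⟩
    exact swap.injective hxg ▸ hx
  have hL : ∀ r : Fin 3 → MvPolynomial (Fin 2) K, eval ![0, 1] (swap (ofVec r)) =
      linearForm fun i => eval ![0, 1] (r i) := fun r => by
    rw [cons_zero_one_eq, eval_swap_ofVec_point]
  obtain ⟨l, hl⟩ := exists_eval_ne_zero hu h.u_coprime (t := ![0, 1]) (by simp)
  -- Specialize u_l²Q ∈ (p, q) at T = (0, 1), with l chosen so that u_l does not vanish there; Q
  -- becomes −F₁.
  obtain ⟨α, β, hF0⟩ : ∃ α β, F 0 = α * eval ![0, 1] (swap (ofVec s)) +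
      β * eval ![0, 1] (swap (ofVec t)) := by
    have hmemQ := C_pow_mul_mem hpq (biPencil_isHomogeneous h.F_homogeneous) hQu l
    obtain ⟨a, b, hab⟩ := Ideal.mem_span_pair.mp hmemQ
    have := congrArg (fun g => eval ![0, 1] (swap g)) hab
    simp only [map_mul, map_add, swap_pencil] at this
    have hv : eval ![0, 1] (swap (C (u l ^ 2) : BiPoly K)) =
        C (eval ![0, 1] (u l) ^ 2) := by
      rw [swap_C, cons_zero_one_eq, eval_map, ← map_pow]
      exact eval₂_comp_left C (RingHom.id K) ![0, 1] (u l ^ 2) |>.symm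
    rw [hv] at this
    simp only [pencil, map_sub, map_mul, eval_X, eval_C, Matrix.cons_val_zero,
      Matrix.cons_val_one, zero_mul, one_mul, zero_sub] at this
    have hinv : (C (eval ![0, 1] (u l) ^ 2)⁻¹ * C (eval ![0, 1] (u l) ^ 2) :
        MvPolynomial (Fin 3) K) = 1 := by
      rw [← C_mul, inv_mul_cancel₀ (pow_ne_zero _ hl), C_1]
    refine ⟨-C (eval ![0, 1] (u l) ^ 2)⁻¹ * eval ![0, 1] (swap a),
      -C (eval ![0, 1] (u l) ^ 2)⁻¹ * eval ![0, 1] (swap b), ?_⟩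
    linear_combination -F 0 * hinv + C (eval ![0, 1] (u l) ^ 2)⁻¹ * this
  -- L and L' are independent because p × q is a nonzero multiple of u, which does not vanish at (0,
  -- 1).
  have hcr : crossProduct (fun i => eval ![0, 1] (s i)) (fun i => eval ![0, 1] (t i)) ≠ 0 := by
    intro h0
    have h1 := congrArg (eval ![0, 1]) (hcross l)
    have h2 := congrFun h0 l
    have h3 : crossProduct (fun i => eval ![0, 1] (s i)) (fun i => eval ![0, 1] (t i)) l =
        eval ![0, 1] (crossProduct s t l) := by
      rw [cross_apply, cross_apply]
      fin_cases l <;> simp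
    rw [h3, h1, map_mul, eval_C] at h2
    exact (mul_ne_zero hc' hl) h2
  obtain ⟨N, hN⟩ := exists_varT_pow_mul_mem hpq hu h.u_coprime hfj hf
  let 𝔎 : Ideal (MvPolynomial (Fin 2) (MvPolynomial (Fin 3) K)) :=
    (reesIdeal u).comap (swap : BiPoly K ≃ₐ[K] _).symm
  have h𝔎 : ∀ g, g ∈ 𝔎 ↔ swap.symm g ∈ reesIdeal u := fun g => Iff.rfl
  have : 𝔎.IsPrime := Ideal.comap_isPrime _ _
  rw [← hmem]
  refine mem_of_X_zero_pow_mul_mem hsi hti (P := 𝔎) ?_ ?_ ?_ hF0 ?_ hfi hi N ?_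
  · rw [h𝔎, ← swap_varT, AlgEquiv.symm_apply_apply]
    exact varT_notMem_reesIdeal u 0
  · rw [Ideal.span_le]
    rintro _ (rfl | rfl | rfl)
    · rw [SetLike.mem_coe, h𝔎, AlgEquiv.symm_apply_apply]; exact ofVec_mem_iff.mpr hsu
    · rw [SetLike.mem_coe, h𝔎, AlgEquiv.symm_apply_apply]; exact ofVec_mem_iff.mpr htu
    · rw [SetLike.mem_coe, h𝔎, ← swap_pencil, AlgEquiv.symm_apply_apply]; exact hQu
  · intro g hg hgk
    obtain ⟨a, rfl⟩ := (swap : BiPoly K ≃ₐ[K] _).surjective g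
    rw [h𝔎, AlgEquiv.symm_apply_apply] at hg
    rw [hmem]
    obtain ⟨b, r, hbr⟩ := h.exists_eq_add two_ne_zero hE hg hgk hsi hc hpE
    rw [hbr]
    exact add_mem (Ideal.mul_mem_left _ _ (Ideal.subset_span (Set.mem_insert _ _)))
      (Ideal.mul_mem_left _ _ (Ideal.subset_span
        (Set.mem_insert_of_mem _ (Set.mem_insert_of_mem _ rfl))))
  · intro x y hxy
    simp only [hL] at hxy ⊢
    exact linearForm_syzygy hcr hxy
  · rw [← swap_varT, ← map_pow, ← map_mul, hmem]
    refine Ideal.span_mono ?_ hN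
    rintro x (rfl | rfl)
    · exact Set.mem_insert _ _
    · exact Set.mem_insert_of_mem _ (Set.mem_insert _ _)

theorem IsParameterizableBy.span_generators [IsAlgClosed K]
    (h : IsParameterizableBy E 2 F u) (hE : Irreducible E) (hd : E.IsHomogeneous (2 * k + 1))
    {p q : BiPoly K} (hpq : IsMuBasis u k (k + 1) p q) {c : K} (hc : c ≠ 0) {P : ℕ → BiPoly K}
    (hPk : P k = p) (hPu : ∀ j ≤ k, P j ∈ reesIdeal u)
    (hP : ∀ j ≤ k, (swap (P j)).IsHomogeneous j)
    (hPE : ∀ j ≤ k, eval F (swap (P j)) = C c * E) :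
    Ideal.span (Set.range (generators F k q P)) = reesIdeal u := by
  have hinf : Infinite K := IsAlgClosed.instInfinite
  have hq : q ∈ reesIdeal u := by
    have : q ∈ syzModule u := hpq.span_eq ▸ Submodule.subset_span (by simp)
    exact this.1
  have gQ : varT 0 * ofX (F 1) - varT 1 * ofX (F 0) ∈
      Ideal.span (Set.range (generators F k q P)) := Ideal.subset_span ⟨Sum.inl 0, rfl⟩
  have gq : q ∈ Ideal.span (Set.range (generators F k q P)) :=
    Ideal.subset_span ⟨Sum.inl 1, rfl⟩
  have gP : ∀ j ≤ k, P j ∈ Ideal.span (Set.range (generators F k q P)) := fun j hj =>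
    Ideal.subset_span ⟨Sum.inr ⟨j, by omega⟩, rfl⟩
  apply le_antisymm
  · rw [Ideal.span_le]
    rintro _ ⟨(i | j), rfl⟩
    · fin_cases i
      · exact h.biPencil_mem
      · exact hq
    · exact hPu j (by omega)
  · intro f hf
    rw [← sum_homogeneousComponent f]
    refine sum_mem fun j _ => ?_
    have hfj := homogeneousComponent_mem_reesIdeal hf j
    have hj := homogeneousComponent_isHomogeneous j f
    generalize homogeneousComponent j f = g at hfj hj
    rw [← sum_tComponent g]
    refine sum_mem fun i _ => ?_
    have hgi := tComponent_mem_reesIdeal u (h.isHomogeneous_of_conics hE hd) hfj i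
    have hi := swap_tComponent_isHomogeneous i g
    by_cases hik : i ≤ k
    · obtain ⟨a, r, har⟩ := h.exists_eq_add two_ne_zero hE hgi hi (hP i hik) hc (hPE i hik)
      rw [har]
      exact add_mem (Ideal.mul_mem_left _ _ (gP i hik)) (Ideal.mul_mem_left _ _ gQ)
    · have := h.mem_span_of_isMuBasis hE hd hpq hc (hPk ▸ hPE k le_rfl) hgi
        (tComponent_isHomogeneous hj i) hi (by omega)
      refine Ideal.span_le.mpr ?_ this
      rintro _ (rfl | rfl | rfl)
      · exact hPk ▸ gP k le_rfl
      · exact gq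
      · exact gQ

end Generation

/-! ### Bihomogeneous elements and bidegree bounds -/

section Bihomogeneous

variable {K : Type*} [Field K]

theorem isBihomogeneous_iff {f : BiPoly K} {i j : ℕ} :
    IsBihomogeneous f i j ↔ f.IsHomogeneous j ∧ (swap f).IsHomogeneous i :=
  and_congr_right fun _ => swap_isHomogeneous_iff.symm

theorem IsBihomogeneous.mul {f g : BiPoly K} {i j i' j' : ℕ} (hf : IsBihomogeneous f i j)
    (hg : IsBihomogeneous g i' j') : IsBihomogeneous (f * g) (i + i') (j + j') := by
  rw [isBihomogeneous_iff] at hf hg ⊢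
  exact ⟨hf.1.mul hg.1, map_mul swap f g ▸ hf.2.mul hg.2⟩

theorem IsBihomogeneous.add {f g : BiPoly K} {i j : ℕ} (hf : IsBihomogeneous f i j)
    (hg : IsBihomogeneous g i j) : IsBihomogeneous (f + g) i j := by
  rw [isBihomogeneous_iff] at hf hg ⊢
  exact ⟨hf.1.add hg.1, map_add swap f g ▸ hf.2.add hg.2⟩

theorem ofX_isBihomogeneous {G : MvPolynomial (Fin 3) K} {e : ℕ} (hG : G.IsHomogeneous e) :
    IsBihomogeneous (ofX G) 0 e := by
  rw [isBihomogeneous_iff, swap_ofX]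
  exact ⟨ofX_isHomogeneous hG, isHomogeneous_C _ _⟩

theorem biPencil_isBihomogeneous {F : Fin 2 → MvPolynomial (Fin 3) K} {e : ℕ}
    (hF : ∀ i, (F i).IsHomogeneous e) :
    IsBihomogeneous (varT 0 * ofX (F 1) - varT 1 * ofX (F 0)) 1 e := by
  rw [isBihomogeneous_iff, swap_pencil]
  exact ⟨biPencil_isHomogeneous hF, pencil_isHomogeneous F⟩

theorem IsBihomogeneous.exists_eq_add {f : BiPoly K} {i j : ℕ} (hf : IsBihomogeneous f (i + 1) j) :
    ∃ A B : BiPoly K, IsBihomogeneous A i j ∧ IsBihomogeneous B i j ∧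
      f = A * varT 0 + B * varT 1 := by
  obtain ⟨hfj, hfi⟩ := isBihomogeneous_iff.mp hf
  have hmem : swap f ∈ Ideal.span (X '' (Set.univ : Set (Fin 2))) := by
    rw [mem_ideal_span_X_image]
    intro m hm
    by_contra! h0
    have hm0 : m = 0 := Finsupp.ext fun l => h0 l (Set.mem_univ l)
    have hdeg := hfi (mem_support_iff.mp hm)
    rw [hm0, map_zero] at hdeg
    omega
  have himg : X '' (Set.univ : Set (Fin 2)) =
      ({X 0, X 1} : Set (MvPolynomial (Fin 2) (MvPolynomial (Fin 3) K))) := by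
    ext x; simp [Fin.exists_fin_two, eq_comm]
  rw [himg, Ideal.mem_span_pair] at hmem
  obtain ⟨a, b, hab⟩ := hmem
  have hT : f = tComponent i (swap.symm a) * varT 0 + tComponent i (swap.symm b) * varT 1 := by
    apply swap.injective
    have h1 := homogeneousComponent_eq_self hfi
    rw [← hab, map_add, homogeneousComponent_mul_of_le (isHomogeneous_X _ 0) _ (by omega),
      homogeneousComponent_mul_of_le (isHomogeneous_X _ 1) _ (by omega),
      Nat.add_sub_cancel] at h1
    rw [map_add, map_mul, map_mul, swap_varT, swap_varT, tComponent, tComponent,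
      AlgEquiv.apply_symm_apply, AlgEquiv.apply_symm_apply, AlgEquiv.apply_symm_apply,
      AlgEquiv.apply_symm_apply, h1, hab]
  have hC : ∀ l : Fin 2, (varT l : BiPoly K).IsHomogeneous 0 := fun l => isHomogeneous_C _ _
  have hb : ∀ g : BiPoly K, IsBihomogeneous (homogeneousComponent j (tComponent i g)) i j := by
    intro g
    rw [isBihomogeneous_iff]
    refine ⟨homogeneousComponent_isHomogeneous j _, ?_⟩
    rw [homogeneousComponent_tComponent]
    exact swap_tComponent_isHomogeneous i _
  refine ⟨_, _, hb (swap.symm a), hb (swap.symm b), ?_⟩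
  have h2 := congrArg (homogeneousComponent j) hT
  rwa [homogeneousComponent_eq_self hfj, map_add,
    homogeneousComponent_mul_of_le (hC 0) _ (Nat.zero_le j),
    homogeneousComponent_mul_of_le (hC 1) _ (Nat.zero_le j), Nat.sub_zero] at h2

/-- `mem_span_of_degree_le` applied once for X and, after `swap`, once for T. -/
theorem mem_span_of_bidegree_le {ι : Type*} {g : ι → BiPoly K} {a b : ι → ℕ}
    (hg : ∀ i, IsBihomogeneous (g i) (a i) (b i)) {s : Set ι} {f : BiPoly K} {m n : ℕ}
    (hf : IsBihomogeneous f m n) (h : f ∈ Ideal.span (g '' s)) :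
    f ∈ Ideal.span (g '' {i ∈ s | b i ≤ n ∧ a i ≤ m}) := by
  have h1 := mem_span_of_degree_le (fun i => (hg i).1) hf.1 h
  have h2 : ∀ (r : Set ι) (x : BiPoly K), x ∈ Ideal.span (g '' r) ↔
      swap x ∈ Ideal.span ((fun i => swap (g i)) '' r) := by
    intro r x
    have hmap : Ideal.span ((fun i => swap (g i)) '' r) =
        (Ideal.span (g '' r)).map (swap : BiPoly K ≃ₐ[K] _).toRingEquiv := by
      rw [Ideal.map_span, Set.image_image]; rfl
    rw [hmap]
    refine ⟨fun hx => Ideal.mem_map_of_mem _ hx, fun hx => ?_⟩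
    obtain ⟨y, hy, hyx⟩ := (Ideal.mem_map_of_equiv _ _).mp hx
    exact swap.injective hyx ▸ hy
  rw [h2] at h1 ⊢
  have h3 := mem_span_of_degree_le (fun i => (isBihomogeneous_iff.mp (hg i)).2)
    (isBihomogeneous_iff.mp hf).2 h1
  refine Ideal.span_mono (Set.image_mono ?_) h3
  rintro i ⟨⟨h, h'⟩, h''⟩
  exact ⟨h, h', h''⟩

end Bihomogeneous

/-! ### The chain P_k, …, P_0 -/

section Chain

variable {K : Type*} [Field K] {E : MvPolynomial (Fin 3) K} {e k : ℕ}
  {F : Fin 2 → MvPolynomial (Fin 3) K} {u : Fin 3 → MvPolynomial (Fin 2) K}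

theorem exists_isChain (hF : ∀ i, (F i).IsHomogeneous 2) {p : BiPoly K}
    (hp : IsBihomogeneous p k 1) : ∃ P : ℕ → BiPoly K, IsChain F k p P := by
  have key : ∀ r ≤ k, ∃ P : ℕ → BiPoly K, P k = p ∧
      IsBihomogeneous (P (k - r)) (k - r) (2 * r + 1) ∧
      ∀ j < k, k - r ≤ j → ∃ A B : BiPoly K,
        IsBihomogeneous A j (2 * (k - (j + 1)) + 1) ∧
        IsBihomogeneous B j (2 * (k - (j + 1)) + 1) ∧
        P (j + 1) = A * varT 0 + B * varT 1 ∧ P j = A * ofX (F 0) + B * ofX (F 1) := by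
    intro r
    induction r with
    | zero => exact fun _ => ⟨fun _ => p, rfl, by simpa using hp, fun j hj hj' => by omega⟩
    | succ r ih =>
      intro hr
      obtain ⟨P, hPk, hPr, hstep⟩ := ih (by omega)
      obtain ⟨m, hm⟩ : ∃ m, k - r = m + 1 := ⟨k - (r + 1), by omega⟩
      have hm' : k - (r + 1) = m := by omega
      rw [hm] at hPr hstep
      rw [hm']
      obtain ⟨A, B, hA, hB, hAB⟩ := hPr.exists_eq_add
      -- Changing P at m leaves the steps already built intact, as they involve only indices above
      -- m.
      refine ⟨Function.update P m (A * ofX (F 0) + B * ofX (F 1)), ?_, ?_, ?_⟩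
      · rw [Function.update_of_ne (by omega), hPk]
      · rw [Function.update_self]
        have h0 := hA.mul (ofX_isBihomogeneous (hF 0))
        have h1 := hB.mul (ofX_isBihomogeneous (hF 1))
        exact h0.add h1
      · intro j hj hmj
        rcases hmj.eq_or_lt with rfl | hlt
        · rw [Function.update_self, Function.update_of_ne (by omega)]
          have hkr : k - (m + 1) = r := by omega
          rw [hkr]
          exact ⟨A, B, hA, hB, hAB, rfl⟩
        · rw [Function.update_of_ne (by omega), Function.update_of_ne (by omega)]
          exact hstep j hj hlt
  obtain ⟨P, hPk, -, hP⟩ := key k le_rfl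
  exact ⟨P, hPk, fun j hj => hP j hj (by omega)⟩

variable {p : BiPoly K} {P : ℕ → BiPoly K}

theorem IsChain.isBihomogeneous (hP : IsChain F k p P) (hF : ∀ i, (F i).IsHomogeneous 2)
    (hp : IsBihomogeneous p k 1) {j : ℕ} (hj : j ≤ k) :
    IsBihomogeneous (P j) j (2 * (k - j) + 1) := by
  rcases hj.eq_or_lt with rfl | hlt
  · rw [hP.1]; simpa using hp
  · obtain ⟨A, B, hA, hB, -, h⟩ := hP.2 j hlt
    rw [h]
    have h0 := hA.mul (ofX_isBihomogeneous (hF 0))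
    have h1 := hB.mul (ofX_isBihomogeneous (hF 1))
    have := h0.add h1
    rwa [add_zero, show 2 * (k - (j + 1)) + 1 + 2 = 2 * (k - j) + 1 by omega] at this

theorem IsChain.eval_eq (hP : IsChain F k p P) {j : ℕ} (hj : j ≤ k) :
    eval F (swap (P j)) = eval F (swap p) := by
  induction hj using Nat.decreasingInduction with
  | self => rw [hP.1]
  | of_succ j hj ih =>
    obtain ⟨A, B, -, -, h1, h2⟩ := hP.2 j hj
    rw [← ih, h1, h2]
    simp only [map_add, map_mul, swap_varT, swap_ofX, eval_X, eval_C]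

/-- T₁P_j = F₁P_{j+1} + BQ, and T₁ cancels because the Rees ideal is prime. -/
theorem IsChain.mem_reesIdeal [Infinite K] (hP : IsChain F k p P)
    (h : IsParameterizableBy E e F u) (hp : p ∈ reesIdeal u) {j : ℕ} (hj : j ≤ k) :
    P j ∈ reesIdeal u := by
  induction hj using Nat.decreasingInduction with
  | self => rwa [hP.1]
  | of_succ j hj ih =>
    obtain ⟨A, B, -, -, h1, h2⟩ := hP.2 j hj
    have hmem : varT 0 * P j ∈ reesIdeal u := by
      have : varT 0 * P j = ofX (F 0) * P (j + 1) +
          B * (varT 0 * ofX (F 1) - varT 1 * ofX (F 0)) := by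
        rw [h1, h2]; ring
      rw [this]
      exact add_mem (Ideal.mul_mem_left _ _ ih) (Ideal.mul_mem_left _ _ h.biPencil_mem)
    exact ((reesIdeal_isPrime u).mem_or_mem hmem).resolve_left (varT_notMem_reesIdeal u 0)

theorem eq_ofX_of_swap_isHomogeneous_zero {f : BiPoly K} (hf : (swap f).IsHomogeneous 0) :
    f = ofX (eval F (swap f)) := by
  apply swap.injective
  rw [swap_ofX]
  rw [totalDegree_eq_zero_iff_eq_C.mp ((totalDegree_zero_iff_isHomogeneous _).mpr hf), eval_C]

theorem exists_eval_swap_eq [IsAlgClosed K] (h : IsParameterizableBy E 2 F u)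
    (hE : Irreducible E) (hd : E.IsHomogeneous (2 * k + 1)) {q : BiPoly K}
    (hpq : IsMuBasis u k (k + 1) p q) : ∃ c : K, c ≠ 0 ∧ eval F (swap p) = C c * E := by
  have hu : ∀ i, (u i).IsHomogeneous (2 * k + 1) := h.isHomogeneous_of_conics hE hd
  obtain ⟨s, t, rfl, rfl, hs, ht, hsu, htu, c', hc', hcross⟩ := hpq.exists_ofVec
    (fun i => by rw [show k + (k + 1) = 2 * k + 1 by ring]; exact hu i) h.u_coprime
  obtain ⟨c, hc⟩ := eq_C_mul_of_dvd hd (eval_swap_isHomogeneous h.F_homogeneous hs)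
    (h.dvd_eval hE (ofVec_mem_iff.mpr hsu)
      (swap_isHomogeneous_iff.mpr (ofVec_isBihomogeneous hs).2))
  refine ⟨c, ?_, hc⟩
  rintro rfl
  refine eval_swap_ofVec_ne_zero one_lt_two h.F_homogeneous h.F_coprime
    (h.F_zero_ne_zero two_ne_zero) hs ?_ (by rw [hc, C_0, zero_mul])
  rintro rfl
  have := LinearIndependent.pair_iff.mp hpq.linearIndependent 1 0
    (by rw [ofVec_zero, smul_zero, zero_smul, add_zero])
  exact one_ne_zero this.1

end Chain

/-! ### Minimality of the generators -/

section Minimality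

variable {K : Type*} [Field K] {E : MvPolynomial (Fin 3) K} {k : ℕ}
  {F : Fin 2 → MvPolynomial (Fin 3) K} {u : Fin 3 → MvPolynomial (Fin 2) K}

/-- The pencil is irreducible of X-degree 2, so a divisor of X-degree 1 would leave a nonunit
cofactor of X-degree 1. -/
theorem not_dvd_biPencil (hF : ∀ i, (F i).IsHomogeneous 2) (hcop : IsRelPrime (F 0) (F 1))
    (h0 : F 0 ≠ 0) {p : BiPoly K} (hp : p.IsHomogeneous 1) :
    ¬ p ∣ varT 0 * ofX (F 1) - varT 1 * ofX (F 0) := by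
  rintro ⟨r, hr⟩
  have hirr := (pencil_prime hcop h0).irreducible
  rw [← swap_pencil] at hirr
  have hirr' := (MulEquiv.irreducible_iff (swap : BiPoly K ≃ₐ[K] _)).mp hirr
  have hne := hirr'.ne_zero
  have hdeg := (biPencil_isHomogeneous hF).totalDegree hne
  rw [hr] at hne hdeg
  have hpdeg := hp.totalDegree (left_ne_zero_of_mul hne)
  rw [totalDegree_mul_of_isDomain (left_ne_zero_of_mul hne) (right_ne_zero_of_mul hne),
    hpdeg] at hdeg
  rcases hirr'.isUnit_or_isUnit hr with hunit | hunit
  · have := (isUnit_iff_totalDegree_of_isReduced.mp hunit).2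
    omega
  · have := (isUnit_iff_totalDegree_of_isReduced.mp hunit).2
    omega

theorem generators_notMem_span (hk : k ≠ 0) (hF : ∀ i, (F i).IsHomogeneous 2)
    (hcop : IsRelPrime (F 0) (F 1)) (h0 : F 0 ≠ 0) {p q : BiPoly K}
    (hpq : IsMuBasis u k (k + 1) p q) {P : ℕ → BiPoly K} (hPk : P k = p)
    (hP : ∀ j ≤ k, IsBihomogeneous (P j) j (2 * (k - j) + 1))
    (hPne : ∀ j ≤ k, eval F (swap (P j)) ≠ 0) (i : Fin 2 ⊕ Fin (k + 1)) :
    generators F k q P i ∉ Ideal.span (generators F k q P '' {i}ᶜ) := by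
  intro hmem
  let a : Fin 2 ⊕ Fin (k + 1) → ℕ := Sum.elim ![1, k + 1] fun j => j
  let b : Fin 2 ⊕ Fin (k + 1) → ℕ := Sum.elim ![2, 1] fun j => 2 * (k - j) + 1
  have hg : ∀ l, IsBihomogeneous (generators F k q P l) (a l) (b l) := by
    rintro (l | l)
    · fin_cases l
      · exact biPencil_isBihomogeneous hF
      · exact hpq.bihomogeneous_q
    · exact hP l (by omega)
  have hmem := mem_span_of_bidegree_le hg (hg i) hmem
  have hsingle : ∀ l, ({j ∈ ({i}ᶜ : Set _) | b j ≤ b i ∧ a j ≤ a i} ⊆ {l}) →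
      generators F k q P l ∣ generators F k q P i := by
    intro l hl
    have := Ideal.span_mono (Set.image_mono hl) hmem
    rwa [Set.image_singleton, Ideal.mem_span_singleton] at this
  rcases i with i | j
  · fin_cases i
    -- Bidegree (1, 2): q is excluded since k + 1 > 1, and only P_k has X-degree at most 2 among the
    -- P_l.
    · have := hsingle (Sum.inr (Fin.last k)) (by
        rintro (l | l) ⟨hl, hbl, hal⟩
        · fin_cases l
          · exact absurd rfl hl
          · change k + 1 ≤ 1 at hal
            omega
        · change 2 * (k - (l : ℕ)) + 1 ≤ 2 at hbl
          rw [Set.mem_singleton_iff]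
          congr 1
          ext
          rw [Fin.val_last]
          omega)
      refine not_dvd_biPencil hF hcop h0 hpq.bihomogeneous_p.1 ?_
      change P k ∣ _ at this
      rwa [hPk] at this
    -- X-degree 1 leaves only p; the cofactor then lies in K[T], against linear independence.
    · obtain ⟨r, hr⟩ := hsingle (Sum.inr (Fin.last k)) (by
        rintro (l | l) ⟨hl, hbl, hal⟩
        · fin_cases l
          · change 2 ≤ 1 at hbl
            omega
          · exact absurd rfl hl
        · change 2 * (k - (l : ℕ)) + 1 ≤ 1 at hbl
          rw [Set.mem_singleton_iff]
          congr 1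
          ext
          rw [Fin.val_last]
          omega)
      change q = P k * r at hr
      rw [hPk, mul_comm] at hr
      have h1 := homogeneousComponent_eq_self hpq.bihomogeneous_q.1
      rw [hr, homogeneousComponent_mul_of_le hpq.bihomogeneous_p.1 _ le_rfl, ← hr, Nat.sub_self,
        homogeneousComponent_zero] at h1
      have := LinearIndependent.pair_iff.mp hpq.linearIndependent (coeff 0 r) (-1)
        (by rw [smul_eq_C_mul, h1, neg_one_smul, add_neg_cancel])
      exact one_ne_zero (neg_eq_zero.mp this.2)
  -- Along the chain the X-degree falls as the T-degree rises, so no other P_l fits below P_j. A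
  -- multiple of the pencil would vanish under T ↦ F(X), but P_j does not.
  · obtain ⟨r, hr⟩ := hsingle (Sum.inl 0) (by
      rintro (l | l) ⟨hl, hbl, hal⟩
      · fin_cases l
        · rfl
        · change k + 1 ≤ (j : ℕ) at hal
          omega
      · change 2 * (k - (l : ℕ)) + 1 ≤ 2 * (k - (j : ℕ)) + 1 at hbl
        change (l : ℕ) ≤ j at hal
        refine absurd ?_ hl
        rw [Set.mem_singleton_iff]
        congr 1
        ext
        omega)
    refine hPne j (by omega) ?_
    change P j = (varT 0 * ofX (F 1) - varT 1 * ofX (F 0)) * r at hr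
    rw [hr, map_mul, swap_pencil, map_mul, eval_pencil, zero_mul]

end Minimality

/-! ### The case of a linear parameterization -/

section Lines

variable {K : Type*} [Field K] [IsAlgClosed K] {E : MvPolynomial (Fin 3) K} {e : ℕ}
  {F : Fin 2 → MvPolynomial (Fin 3) K} {u : Fin 3 → MvPolynomial (Fin 2) K}

/-- A curve with a parameterization by linear forms is parameterizable by lines. -/
theorem IsParameterizableBy.exists_lines (h : IsParameterizableBy E e F u) (hE : Irreducible E)
    (hu : ∀ i, (u i).IsHomogeneous 1) : ∃ G, IsParameterizableBy E 1 G u := by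
  have hex : ∀ i, ∃ γ : Fin 2 → K, u i = C (γ 0) * X 0 + C (γ 1) * X 1 := by
    intro i
    have hi : u i ∈ homogeneousSubmodule (Fin 2) K 1 := hu i
    rw [homogeneousSubmodule_one_eq_span_X, Submodule.mem_span_range_iff_exists_fun] at hi
    obtain ⟨γ, hγ⟩ := hi
    exact ⟨γ, by rw [← hγ, Fin.sum_univ_two, smul_eq_C_mul, smul_eq_C_mul]⟩
  choose γ hγ using hex
  have hev : ∀ t i, eval t (u i) = γ i 0 * t 0 + γ i 1 * t 1 := fun t i => by simp [hγ i]
  -- If all minors of the coefficient matrix vanished, the u_i would have the common zero (γ_{j1},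
  -- −γ_{j0}).
  obtain ⟨j, l, hD⟩ : ∃ j l, γ j 0 * γ l 1 - γ l 0 * γ j 1 ≠ 0 := by
    by_contra! h0
    obtain ⟨j, hj⟩ : ∃ j, γ j ≠ 0 := by
      obtain ⟨j, hj⟩ := exists_eval_ne_zero hu h.u_coprime (t := ![1, 0]) (by simp)
      refine ⟨j, fun hj0 => hj ?_⟩
      rw [hev, hj0]; simp
    obtain ⟨i, hi⟩ := exists_eval_ne_zero hu h.u_coprime (t := ![γ j 1, -γ j 0]) (by
      intro h1
      refine hj (funext fun i => ?_)
      have e0 := congrFun h1 0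
      have e1 := congrFun h1 1
      fin_cases i
      · simpa using e1
      · simpa using e0)
    refine hi ?_
    rw [hev]
    simp only [Matrix.cons_val_zero, Matrix.cons_val_one]
    linear_combination h0 i j
  set D := γ j 0 * γ l 1 - γ l 0 * γ j 1 with hDdef
  have hDC : (C D⁻¹ * (C (γ j 0) * C (γ l 1) - C (γ l 0) * C (γ j 1)) :
      MvPolynomial (Fin 3) K) = 1 := by
    rw [← C_mul, ← C_mul, ← C_sub, ← C_mul, inv_mul_cancel₀ hD, C_1]
  have hDC' : (C D⁻¹ * (C (γ j 0) * C (γ l 1) - C (γ l 0) * C (γ j 1)) :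
      MvPolynomial (Fin 2) K) = 1 := by
    rw [← C_mul, ← C_mul, ← C_sub, ← C_mul, inv_mul_cancel₀ hD, C_1]
  have hjl : j ≠ l := by rintro rfl; exact hD (by rw [hDdef, sub_self])
  -- Cramer's rule: G inverts the two rows j and l of u.
  let G : Fin 2 → MvPolynomial (Fin 3) K :=
    ![C D⁻¹ * (C (γ l 1) * X j - C (γ j 1) * X l), C D⁻¹ * (C (γ j 0) * X l - C (γ l 0) * X j)]
  have hG : ∀ i, (G i).IsHomogeneous 1 := by
    intro i
    fin_cases i
    · exact ((isHomogeneous_C_mul_X _ _).sub (isHomogeneous_C_mul_X _ _)).C_mul _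
    · exact ((isHomogeneous_C_mul_X _ _).sub (isHomogeneous_C_mul_X _ _)).C_mul _
  have hXj : X j = C (γ j 0) * G 0 + C (γ j 1) * G 1 := by
    simp only [G, Matrix.cons_val_zero, Matrix.cons_val_one]
    linear_combination -X j * hDC
  have hXl : X l = C (γ l 0) * G 0 + C (γ l 1) * G 1 := by
    simp only [G, Matrix.cons_val_zero, Matrix.cons_val_one]
    linear_combination -X l * hDC
  have hGu : ∀ i, aeval u (G i) = X i := by
    intro i
    fin_cases i
    · simp [G, hγ, -map_inv₀]
      linear_combination X 0 * hDC'
    · simp [G, hγ, -map_inv₀]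
      linear_combination X 1 * hDC'
  refine ⟨G, hG, ?_, h.u_homogeneous, h.u_coprime, h.maps_to, ⟨1, ⟨0, isHomogeneous_one _ _⟩,
    one_ne_zero, ?_⟩, ⟨1, ⟨0, isHomogeneous_one _ _⟩, ?_, ?_⟩⟩
  · intro d hd0 hd1
    have hdj : d ∣ X j := hXj ▸ dvd_add (hd0.mul_left _) (hd1.mul_left _)
    have hdl : d ∣ X l := hXl ▸ dvd_add (hd0.mul_left _) (hd1.mul_left _)
    have hirr : Irreducible (X j : MvPolynomial (Fin 3) K) := by
      have := (linearForm_prime (l := Pi.single j (1 : K)) (by simp)).irreducible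
      rwa [show linearForm (Pi.single j (1 : K)) = X j by
        rw [linearForm, Finset.sum_eq_single j (fun i _ hi => by simp [hi]) (by simp)]
        simp] at this
    by_contra hunit
    obtain ⟨r, hr⟩ := hdj
    obtain ⟨w, hw⟩ := (hirr.isUnit_or_isUnit hr).resolve_left hunit
    have hjdl : (X j : MvPolynomial (Fin 3) K) ∣ X l := by
      rw [hr, ← hw, Units.mul_right_dvd]
      exact hdl
    obtain ⟨r', hr'⟩ := hjdl
    have := congrArg (eval (Pi.single l (1 : K))) hr'
    simp [hjl] at this
  · intro t ht _
    have : evalTuple G (evalTuple u t) = t := by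
      funext i
      change eval (evalTuple u t) (G i) = t i
      rw [eval_evalTuple, hGu, eval_X]
    rw [this]
    exact ⟨ht, ht, rfl⟩
  · exact fun hdvd => hE.not_isUnit (isUnit_of_dvd_one hdvd)
  · intro x hx hEx _
    have : evalTuple u (evalTuple G x) = x := by
      funext i
      change eval (evalTuple G x) (u i) = x i
      rw [eval_evalTuple]
      -- The form u_i(G(X)) − X_i vanishes under X ↦ u because G(u) = T, so E divides it and it is
      -- zero on C.
      have hhom : (aeval G (u i) - X i).IsHomogeneous 1 := by
        have := (hu i).aeval G hG
        exact this.sub (isHomogeneous_X _ i)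
      have hzero : aeval u (aeval G (u i) - X i) = 0 := by
        rw [map_sub, aeval_X, comp_aeval_apply]
        have : (fun i => aeval u (G i)) = X := funext hGu
        rw [this, aeval_X_left_apply, sub_self]
      obtain ⟨r, hr⟩ := h.dvd_of_aeval_eq_zero hE hhom hzero
      have := congrArg (eval x) hr
      rw [map_sub, map_mul, hEx, zero_mul, eval_X] at this
      exact sub_eq_zero.mp this
    rw [this]
    exact ⟨hx, hx, rfl⟩

end Lines

end RatCurve

end

/-! ### Assembly of the theorem -/

theorem theorem5p3 {K : Type*} [Field K] [IsAlgClosed K] (k : ℕ)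
    (E : MvPolynomial (Fin 3) K) (hE : Irreducible E) (hEdeg : E.IsHomogeneous (2 * k + 1))
    (F : Fin 2 → MvPolynomial (Fin 3) K) (u : Fin 3 → MvPolynomial (Fin 2) K)
    (hconics : RatCurve.IsParameterizableBy E 2 F u)
    (hlines : ¬ ∃ (G : Fin 2 → MvPolynomial (Fin 3) K) (v : Fin 3 → MvPolynomial (Fin 2) K),
      RatCurve.IsParameterizableBy E 1 G v) :
    (∃ p q : RatCurve.BiPoly K, RatCurve.IsMuBasis u k (k + 1) p q) ∧
    ∀ p q : RatCurve.BiPoly K, RatCurve.IsMuBasis u k (k + 1) p q →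
      (∃ P : ℕ → RatCurve.BiPoly K, RatCurve.IsChain F k p P) ∧
      ∀ P : ℕ → RatCurve.BiPoly K, RatCurve.IsChain F k p P →
        (∀ j ≤ k, RatCurve.IsBihomogeneous (P j) j (2 * (k - j) + 1)) ∧
        (∃ c : K, c ≠ 0 ∧ P 0 = RatCurve.ofX (MvPolynomial.C c * E)) ∧
        RatCurve.IsMinimalGenerators (RatCurve.reesIdeal u)
          (RatCurve.generators F k q P) := by
  have hinf : Infinite K := IsAlgClosed.instInfinite
  -- For k = 0 the u_i are linear, so `exists_lines` contradicts `hlines`.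
  have hk : k ≠ 0 := by
    rintro rfl
    obtain ⟨G, hG⟩ := hconics.exists_lines hE fun i => hconics.isHomogeneous_of_conics hE hEdeg i
    exact hlines ⟨G, u, hG⟩
  refine ⟨RatCurve.exists_isMuBasis hconics hE hEdeg, fun p q hpq =>
    ⟨RatCurve.exists_isChain hconics.F_homogeneous hpq.bihomogeneous_p, fun P hP => ?_⟩⟩
  have hbi : ∀ j ≤ k, RatCurve.IsBihomogeneous (P j) j (2 * (k - j) + 1) := fun j hj =>
    hP.isBihomogeneous hconics.F_homogeneous hpq.bihomogeneous_p hj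
  have hT : ∀ j ≤ k, (RatCurve.swap (P j)).IsHomogeneous j := fun j hj =>
    (RatCurve.isBihomogeneous_iff.mp (hbi j hj)).2
  obtain ⟨c, hc, hcE⟩ := RatCurve.exists_eval_swap_eq hconics hE hEdeg hpq
  have hPE : ∀ j ≤ k, MvPolynomial.eval F (RatCurve.swap (P j)) = MvPolynomial.C c * E :=
    fun j hj => (hP.eval_eq hj).trans hcE
  have hp : p ∈ RatCurve.reesIdeal u := by
    have : p ∈ RatCurve.syzModule u := hpq.span_eq ▸ Submodule.subset_span (by simp)
    exact this.1
  refine ⟨hbi, ⟨c, hc, ?_⟩, ?_, ?_⟩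
  · rw [← hPE 0 (Nat.zero_le k)]
    exact RatCurve.eq_ofX_of_swap_isHomogeneous_zero (hT 0 (Nat.zero_le k))
  · exact hconics.span_generators hE hEdeg hpq hc hP.1
      (fun j hj => hP.mem_reesIdeal hconics hp hj) hT hPE
  · refine RatCurve.generators_notMem_span hk hconics.F_homogeneous hconics.F_coprime
      (hconics.F_zero_ne_zero two_ne_zero) hpq hP.1 hbi fun j hj => ?_
    rw [hPE j hj]
    exact mul_ne_zero (by simpa using hc) hE.ne_zero
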